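/- Let $H$ be a finite simple connected graph with $|V(H)|\ge 2$ vertices, and let $W:[0,1]^2\to[0,1]$ be a graphon (a symmetric measurable function) with $$t(H,W)=\int_{[0,1]^{|V(H)|}}\prod_{(i,j)\in E(H)}W(x_i,x_j)\,dx_1\cdots dx_{|V(H)|}>0.$$ Let $(G_n)$ be a sequence of finite simple graphs on the (non-empty) vertex sets $V(G_n)=\{1,\dots,|V(G_n)|\}$ that converges to $W$, that is, $|\hom(F,G_n)|/|V(G_n)|^{|V(F)|}\to t(F,W)$ for every finite simple graph $F$. Let $c_n\ge 1$ be integers with $c_n\to\infty$. Color the vertices of $G_n$ independently and uniformly with $c_n$ colors, write $X_v$ for the color of the vertex $v$, and let $$T(H,G_n)=\frac1{|\mathrm{Aut}(H)|}\sum_{s}\ \prod_{(a,b)\in E(H)}a_{s_as_b}(G_n)\ \mathbf 1\{X_{s_1}=\cdots=X_{s_{|V(H)|}}\}$$ be the number of monochromatic copies of $H$, where the sum is over all $|V(H)|$-tuples $s$ of distinct vertices of $G_n$ and $(a_{uv}(G_n))$ is the adjacency matrix of $G_n$. Put $$Z(H,G_n)=\frac{T(H,G_n)-\mathbb E\,T(H,G_n)}{\sqrt{\mathrm{Var}\,T(H,G_n)}}$$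 (with $Z(H,G_n)=0$ if the variance vanishes). For probability measures on $\mathbb R$ let $\mathrm{Wass}(\mu,\nu)=\sup\{\int f\,d\nu-\int f\,d\mu : f:\mathbb R\to\mathbb R \text{ is 1-Lipschitz}\}$; for a random variable $Z$, $\mathrm{Wass}(Z,\nu)$ means that its law is taken for $\mu$. Then $$\mathrm{Wass}\bigl(Z(H,G_n),N(0,1)\bigr)\ \le\ C\left[\left(\frac{c_n^{|V(H)|-1}}{|V(G_n)|^{|V(H)|}}\right)^{1/2}+\left(\frac1{c_n}\right)^{1/2}\right]$$ for all sufficiently large $n$, with a constant $C$ that depends only on $H$ and $W$; and the same bound holds for all $n$ with a constant that may also depend on the sequences $(G_n)$ and $(c_n)$. Moreover, if $\mathbb E\,T(H,G_n)\to\infty$, then $\mathrm{Var}\,T(H,G_n)>0$ for all large $n$, and $Z(H,G_n)$ converges in distribution to $N(0,1)$. -/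

import Mathlib

open MeasureTheory ProbabilityTheory Filter Topology
open scoped ENNReal unitInterval

noncomputable section

namespace MonoSubgraph

/-- A graphon: a symmetric measurable function from `[0,1]²` to `[0,1]`. -/
structure Graphon where
  toFun : I → I → ℝ
  measurable' : Measurable (Function.uncurry toFun)
  symm' : ∀ x y, toFun x y = toFun y x
  mem_Icc' : ∀ x y, toFun x y ∈ Set.Icc (0 : ℝ) 1

open Classical in
/-- The edges of `F`, each listed once, as the pair `(i, j)` with `i < j`. -/
def edgePairs {k : ℕ} (F : SimpleGraph (Fin k)) : Finset (Fin k × Fin k) :=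
  Finset.univ.filter fun p => p.1 < p.2 ∧ F.Adj p.1 p.2

/-- The homomorphism density `t(F, G) = |hom(F, G)| / |V(G)| ^ |V(F)|`. -/
def homDensity {k N : ℕ} (F : SimpleGraph (Fin k)) (G : SimpleGraph (Fin N)) : ℝ :=
  (Nat.card (F →g G) : ℝ) / (N : ℝ) ^ k

/-- The homomorphism density `t(F, W)` of a finite graph in a graphon. -/
def graphonDensity {k : ℕ} (F : SimpleGraph (Fin k)) (W : Graphon) : ℝ :=
  ∫ x : Fin k → I, ∏ p ∈ edgePairs F, W.toFun (x p.1) (x p.2)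

/-- `G n` converges to the graphon `W`: `t(F, G n) → t(F, W)` for every finite simple graph `F`. -/
def ConvergesTo {N : ℕ → ℕ} (G : ∀ n, SimpleGraph (Fin (N n))) (W : Graphon) : Prop :=
  ∀ (k : ℕ) (F : SimpleGraph (Fin k)),
    Tendsto (fun n => homDensity F (G n)) atTop (𝓝 (graphonDensity F W))

/-- The law of a uniformly random `c`-coloring of `{1, …, N}`: the colors of the vertices are
independent and uniform on the `c` colors. -/
def colorMeasure (N c : ℕ) : Measure (Fin N → Fin c) :=
  Measure.pi fun _ => uniformOn (Set.univ : Set (Fin c))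

instance colorMeasure_isProbabilityMeasure (N c : ℕ) [NeZero c] :
    IsProbabilityMeasure (colorMeasure N c) := by
  unfold colorMeasure
  infer_instance

open Classical in
/-- The number `T(H, G)` of monochromatic copies of `H` in `G` under the coloring `X`: the sum over
all tuples `s` of distinct vertices of `G`, indexed by the vertices of `H`, of the product of the
entries of the adjacency matrix of `G` along the edges of `H`, times the indicator that all `s i`
have the same color, divided by the number of automorphisms of `H`. -/
def monoCount {r N c : ℕ} (H : SimpleGraph (Fin r)) (G : SimpleGraph (Fin N))
    (X : Fin N → Fin c) : ℝ :=
  (1 / (Nat.card (H ≃g H) : ℝ)) *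
    ∑ s : Fin r ↪ Fin N,
      (∏ p ∈ edgePairs H, G.adjMatrix ℝ (s p.1) (s p.2)) *
        (if ∀ i j, X (s i) = X (s j) then 1 else 0)

/-- The mean of `T(H, G)` under a uniformly random `c`-coloring. -/
def meanT {r N : ℕ} (H : SimpleGraph (Fin r)) (G : SimpleGraph (Fin N)) (c : ℕ) : ℝ :=
  ∫ X, monoCount H G X ∂(colorMeasure N c)

/-- The variance of `T(H, G)` under a uniformly random `c`-coloring. -/
def varT {r N : ℕ} (H : SimpleGraph (Fin r)) (G : SimpleGraph (Fin N)) (c : ℕ) : ℝ :=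
  variance (fun X => monoCount H G X) (colorMeasure N c)

/-- The standardized count `Z(H, G) = (T(H, G) - 𝔼 T(H, G)) / √Var(T(H, G))`
(equal to `0` when the variance vanishes). -/
def stdCount {r N c : ℕ} (H : SimpleGraph (Fin r)) (G : SimpleGraph (Fin N))
    (X : Fin N → Fin c) : ℝ :=
  (monoCount H G X - meanT H G c) / √(varT H G c)

/-- The Wasserstein distance between probability measures on `ℝ` with finite first moment: the
supremum of `∫ f dν - ∫ f dμ` over all `1`-Lipschitz functions `f`. (Since `f` may be replaced by
`-f`, cutting the negative values off at `0` does not change the supremum.) -/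
def wasserstein (μ ν : Measure ℝ) : ℝ≥0∞ :=
  ⨆ (f : ℝ → ℝ) (_ : LipschitzWith 1 f), ENNReal.ofReal (∫ x, f x ∂ν - ∫ x, f x ∂μ)

end MonoSubgraph

end

open MonoSubgraph

noncomputable section

namespace MonoSubgraph

/-! Up to the factor `1 / |Aut H|`, which cancels on standardizing, the count is `T = ∑ a s * 1{s
monochromatic}` over injective `r`-tuples `s`, with weights `a s ∈ {0, 1}`. Normality comes from
Stein's method with two families indexed by the vertices `j`. Let `R j` be `T` minus its average
over the color of `j`. Reveal the colors of each tuple in the order of its entries, and let `A j`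
collect the increments due to revealing `j`; then `∑ A j = T - 𝔼 T`, and each `A j` averages to zero
over the color of `j`. Taylor expansion of the Stein solution bounds the error by `𝔼 |1 - ∑ A j R j
/ σ²|` and `𝔼 ∑ |A j| R j² / σ³` (`abs_avg_sub_integral_le`), hence by `∑ 𝔼 A j²`, `∑ 𝔼 R j⁴` and
`Var (∑ A j R j)`.

With `N` vertices and `c` colors, these moments expand into sums over two or four tuples. A
connected family of tuples with `m` vertices contributes `O(c^(1-m))`, as every new vertex must copy
a given color (`avg_mul_condMono_le`), and there are `O(N^m)` such families. Tuples overlapping too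
little contribute nothing: since nothing changes when the colors are permuted, functions with at
most one common vertex are uncorrelated (`avg_mul_of_invariant`). Hence `r ≤ m ≤ 2r - 2` for pairs
and `r ≤ m ≤ 4r - 4` for quadruples. With `x = (N/c)^r` and `y = (N/c)^(2r-2)` the sums are `O(c(x +
y))` and `O(c(x + y²))`.

Conversely, all covariances of monochromatic indicators are nonnegative once `c ≥ 2`, and if a
positive fraction of all tuples are copies, then `σ²` is at least a constant times `c(x + y)`
(`le_variance`). As `c(x + y²) ≤ (c(x + y))² * (1/c + c^(r-1)/N^r)`, the error has the stated rate.
The assumption `t(H, W) > 0` supplies that fraction, noninjective homomorphisms being negligible.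
Finally `𝔼 T ≤ N^r / c^(r-1)`, so a diverging mean forces the rate to zero. -/

/-! ### Gaussian integrals and bounds on the solution of Stein's equation -/

/-- The unnormalized Gaussian density `exp (-t² / 2)`. -/
def gaussExp (t : ℝ) : ℝ := Real.exp (-(t ^ 2 / 2))

lemma gaussExp_pos (t : ℝ) : 0 < gaussExp t := Real.exp_pos _

lemma hasDerivAt_gaussExp (t : ℝ) : HasDerivAt gaussExp (-t * gaussExp t) t := by
  have h : HasDerivAt (fun t : ℝ => -(t ^ 2 / 2)) (-t) t := by
    have := ((hasDerivAt_pow 2 t).div_const 2).fun_neg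
    simpa using this
  rw [mul_comm]
  exact h.exp

lemma continuous_gaussExp : Continuous gaussExp := by
  unfold gaussExp; fun_prop

lemma gaussExp_neg (t : ℝ) : gaussExp (-t) = gaussExp t := by simp [gaussExp]

lemma gaussExp_eq (t : ℝ) : gaussExp t = Real.exp (-(1 / 2) * t ^ 2) := by
  unfold gaussExp; congr 1; ring

lemma integrable_gaussExp : Integrable gaussExp := by
  have := integrable_exp_neg_mul_sq (b := 1 / 2) (by norm_num)
  refine this.congr (ae_of_all _ fun t => (gaussExp_eq t).symm)

lemma integrable_abs_mul_gaussExp : Integrable (fun t => |t| * gaussExp t) := by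
  have := (integrable_mul_exp_neg_mul_sq (b := 1 / 2) (by norm_num)).abs
  refine this.congr (ae_of_all _ fun t => ?_)
  simp only [abs_mul, gaussExp_eq, abs_of_pos (Real.exp_pos _)]

lemma integrable_lipschitz_mul_gaussExp {h : ℝ → ℝ} (hh : LipschitzWith 1 h) :
    Integrable (fun t => h t * gaussExp t) := by
  refine ((integrable_gaussExp.const_mul |h 0|).add integrable_abs_mul_gaussExp).mono'
    ((hh.continuous.mul continuous_gaussExp).aestronglyMeasurable) (ae_of_all _ fun t => ?_)
  have h1 : |h t - h 0| ≤ |t| := by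
    have := hh.dist_le_mul t 0
    simpa [Real.dist_eq] using this
  have h2 : |h t| ≤ |h 0| + |t| := by
    have := abs_sub_abs_le_abs_sub (h t) (h 0)
    linarith
  simp only [Pi.add_apply, Real.norm_eq_abs, abs_mul, abs_of_pos (gaussExp_pos t)]
  nlinarith [gaussExp_pos t]

lemma gaussianPDFReal_eq_gaussExp (t : ℝ) :
    gaussianPDFReal 0 1 t = (√(2 * Real.pi))⁻¹ * gaussExp t := by
  simp [gaussianPDFReal, gaussExp, neg_div]

lemma integral_gaussianReal_eq (h : ℝ → ℝ) :
    ∫ t, h t ∂(gaussianReal 0 1) = (√(2 * Real.pi))⁻¹ * ∫ t, h t * gaussExp t := by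
  rw [integral_gaussianReal_eq_integral_smul (by norm_num), ← integral_const_mul]
  refine integral_congr_ae (ae_of_all _ fun t => ?_)
  simp only [gaussianPDFReal_eq_gaussExp, smul_eq_mul]
  ring

lemma integral_gaussExp : ∫ t, gaussExp t = √(2 * Real.pi) := by
  have := integral_gaussian (1 / 2)
  simp_rw [← gaussExp_eq] at this
  rw [this]; congr 1; field_simp

lemma integral_sub_mean_mul_gaussExp {h : ℝ → ℝ} (hh : LipschitzWith 1 h) :
    ∫ t, (h t - ∫ u, h u ∂(gaussianReal 0 1)) * gaussExp t = 0 := by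
  simp_rw [sub_mul]
  rw [integral_sub (integrable_lipschitz_mul_gaussExp hh) (integrable_gaussExp.const_mul _),
    integral_const_mul, integral_gaussExp, integral_gaussianReal_eq]
  have : √(2 * Real.pi) ≠ 0 := by positivity
  field_simp
  simp

lemma integrable_lipschitz_gaussianReal {h : ℝ → ℝ} (hh : LipschitzWith 1 h) :
    Integrable h (gaussianReal 0 1) := by
  have h1 : Integrable (fun t : ℝ => |h 0| + |t|) (gaussianReal 0 1) :=
    (integrable_const _).add ((memLp_id_gaussianReal (μ := 0) (v := 1) 1).integrable le_rfl).abs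
  refine h1.mono' hh.continuous.aestronglyMeasurable (ae_of_all _ fun t => ?_)
  have h1 : |h t - h 0| ≤ |t| := by
    have := hh.dist_le_mul t 0
    simpa [Real.dist_eq] using this
  have := abs_sub_abs_le_abs_sub (h t) (h 0)
  rw [Real.norm_eq_abs]
  linarith

lemma integral_abs_gaussianReal_le : ∫ t, |t| ∂(gaussianReal 0 1) ≤ 1 := by
  have h2 : Integrable (fun t : ℝ => t ^ 2) (gaussianReal 0 1) :=
    (memLp_id_gaussianReal (μ := 0) (v := 1) 2).integrable_sq
  have h3 : ∫ t, t ^ 2 ∂(gaussianReal 0 1) = 1 := by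
    have h := variance_fun_id_gaussianReal (μ := 0) (v := 1)
    rw [variance_eq_integral aemeasurable_id'] at h
    simpa using h
  calc ∫ t, |t| ∂(gaussianReal 0 1) ≤ ∫ t, (1 / 2 + 1 / 2 * t ^ 2) ∂(gaussianReal 0 1) := by
        refine integral_mono ((memLp_id_gaussianReal (μ := 0) (v := 1) 1).integrable le_rfl).abs
          ((integrable_const _).add (h2.const_mul _)) fun t => ?_
        simp only
        nlinarith [sq_nonneg (|t| - 1), sq_abs t]
    _ = 1 := by
        rw [integral_add (integrable_const _) (h2.const_mul _), integral_const_mul, h3]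
        simp
        norm_num

/-- Averaging `|h x - h u| ≤ |x| + |u|` over a Gaussian `u` costs at most `𝔼 |u| ≤ 1`. -/
lemma abs_sub_mean_le {h : ℝ → ℝ} (hh : LipschitzWith 1 h) (x : ℝ) :
    |h x - ∫ u, h u ∂(gaussianReal 0 1)| ≤ |x| + 1 := by
  have hi := integrable_lipschitz_gaussianReal hh
  have e : h x - ∫ u, h u ∂(gaussianReal 0 1) = ∫ u, (h x - h u) ∂(gaussianReal 0 1) := by
    rw [integral_sub (integrable_const _) hi]; simp
  have hid : Integrable (fun u : ℝ => |u|) (gaussianReal 0 1) :=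
    ((memLp_id_gaussianReal (μ := 0) (v := 1) 1).integrable le_rfl).abs
  rw [e]
  calc |∫ u, (h x - h u) ∂(gaussianReal 0 1)| ≤ ∫ u, |h x - h u| ∂(gaussianReal 0 1) :=
        abs_integral_le_integral_abs
    _ ≤ ∫ u, (|x| + |u|) ∂(gaussianReal 0 1) := by
        refine integral_mono ((integrable_const _).sub hi).abs
          ((integrable_const _).add hid) fun u => ?_
        have := hh.dist_le_mul x u
        simp only [Real.dist_eq, NNReal.coe_one, one_mul] at this
        exact this.trans (abs_sub x u)
    _ = |x| + ∫ u, |u| ∂(gaussianReal 0 1) := by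
        rw [integral_add (integrable_const _) hid]; simp
    _ ≤ |x| + 1 := by gcongr; exact integral_abs_gaussianReal_le

/-- Integration by parts against the Gaussian weight. -/
lemma integral_Ioi_gaussExp_of_hasDerivAt {p p' : ℝ → ℝ} {x : ℝ}
    (hp : ∀ t ∈ Set.Ici x, HasDerivAt p (p' t) t)
    (h0 : ∀ t ∈ Set.Ioi x, 0 ≤ t * p t - p' t)
    (hlim : Tendsto (fun t => p t * gaussExp t) atTop (𝓝 0)) :
    IntegrableOn (fun t => (t * p t - p' t) * gaussExp t) (Set.Ioi x) ∧
      ∫ t in Set.Ioi x, (t * p t - p' t) * gaussExp t = p x * gaussExp x := by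
  have hd : ∀ t ∈ Set.Ici x, HasDerivAt (fun t => -(p t * gaussExp t))
      ((t * p t - p' t) * gaussExp t) t := fun t ht => by
    have := ((hp t ht).fun_mul (hasDerivAt_gaussExp t)).fun_neg
    rwa [show -(p' t * gaussExp t + p t * (-t * gaussExp t)) = (t * p t - p' t) * gaussExp t by
      ring] at this
  have hl : Tendsto (fun t => -(p t * gaussExp t)) atTop (𝓝 0) := by simpa using hlim.neg
  have hn : ∀ t ∈ Set.Ioi x, 0 ≤ (t * p t - p' t) * gaussExp t := fun t ht =>
    mul_nonneg (h0 t ht) (gaussExp_pos t).le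
  refine ⟨integrableOn_Ioi_deriv_of_nonneg' hd hn hl, ?_⟩
  rw [integral_Ioi_of_hasDerivAt_of_nonneg' hd hn hl]
  ring

lemma gaussExp_le_exp_neg {t : ℝ} : gaussExp t ≤ 2 * Real.exp (-t) := by
  have h1 : gaussExp t ≤ Real.exp (1 / 2 + -t) :=
    Real.exp_le_exp.2 (by nlinarith [sq_nonneg (t - 1)])
  rw [Real.exp_add] at h1
  have h2 : Real.exp (1 / 2) ≤ 2 := by
    have h3 : Real.exp (1 / 2) ^ 2 = Real.exp 1 := by rw [← Real.exp_nat_mul]; norm_num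
    have := Real.exp_one_lt_d9
    nlinarith [Real.exp_pos (1 / 2)]
  exact h1.trans (mul_le_mul_of_nonneg_right h2 (Real.exp_pos _).le)

lemma tendsto_linear_mul_gaussExp (a b : ℝ) :
    Tendsto (fun t => (a + b * t) * gaussExp t) atTop (𝓝 0) := by
  have h0 : Tendsto gaussExp atTop (𝓝 0) := by
    refine squeeze_zero (fun t => (gaussExp_pos t).le) (fun t => gaussExp_le_exp_neg) ?_
    simpa using (Real.tendsto_exp_neg_atTop_nhds_zero).const_mul 2
  have h1 : Tendsto (fun t => t * gaussExp t) atTop (𝓝 0) := by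
    refine squeeze_zero' (f := fun t => t * gaussExp t) (g := fun t => 2 * (t ^ 1 * Real.exp (-t)))
      ?_ ?_ ?_
    · filter_upwards [eventually_ge_atTop 0] with t ht using mul_nonneg ht (gaussExp_pos t).le
    · filter_upwards [eventually_ge_atTop 0] with t ht
      have := mul_le_mul_of_nonneg_left (gaussExp_le_exp_neg (t := t)) ht
      linarith
    · simpa using (Real.tendsto_pow_mul_exp_neg_atTop_nhds_zero 1).const_mul 2
  have := (h0.const_mul a).add (h1.const_mul b)
  simp only [mul_zero, add_zero] at this
  refine this.congr fun t => by ring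

lemma integral_Ioi_id_mul_gaussExp {x : ℝ} (hx : 0 ≤ x) :
    IntegrableOn (fun t => t * gaussExp t) (Set.Ioi x) ∧
      ∫ t in Set.Ioi x, t * gaussExp t = gaussExp x := by
  have := integral_Ioi_gaussExp_of_hasDerivAt (p := fun _ => 1) (p' := fun _ => 0) (x := x)
    (fun t _ => hasDerivAt_const _ _) (fun t ht => by
      have : x < t := ht
      simp; linarith) (by simpa using tendsto_linear_mul_gaussExp 1 0)
  simpa using this

lemma integral_Ioi_sub_mul_gaussExp_le {x : ℝ} (hx : 0 ≤ x) :
    (1 + x ^ 2) * ∫ t in Set.Ioi x, (t - x) * gaussExp t ≤ gaussExp x := by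
  -- This `p` has `p x = 1` and `t * p t - p' t = (t - x) * (1 + x * t)`, which is at least `(t - x)
  -- * (1 + x ^ 2)` for `t > x ≥ 0`.
  have h := integral_Ioi_gaussExp_of_hasDerivAt (p := fun t => 1 + x * (t - x))
    (p' := fun _ => x) (x := x) (fun t _ => by
      have := (((hasDerivAt_id t).sub_const x).const_mul x).const_add 1
      simpa using this) (fun t ht => by
      have : x < t := ht
      nlinarith [mul_nonneg (mul_nonneg hx (hx.trans this.le)) (sub_nonneg.2 this.le)])
    (by
      refine (tendsto_linear_mul_gaussExp (1 - x * x) x).congr fun t => by ring)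
  have hi := (integral_Ioi_id_mul_gaussExp hx).1
  have hj : IntegrableOn (fun t => (t - x) * gaussExp t) (Set.Ioi x) := by
    have := hi.sub ((integrable_gaussExp.const_mul x).integrableOn (s := Set.Ioi x))
    refine this.congr (ae_of_all _ fun t => ?_)
    simp; ring
  rw [← integral_const_mul]
  calc _ ≤ ∫ t in Set.Ioi x, (t * (1 + x * (t - x)) - x) * gaussExp t := by
        refine setIntegral_mono_on (hj.const_mul _) h.1 measurableSet_Ioi fun t ht => ?_
        have : x < t := ht
        rw [← mul_assoc]
        refine mul_le_mul_of_nonneg_right ?_ (gaussExp_pos t).le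
        nlinarith [mul_nonneg hx (sq_nonneg (t - x))]
    _ = gaussExp x := by rw [h.2]; simp

lemma integral_Ioi_gaussExp_le {x : ℝ} (hx : 0 ≤ x) :
    ∫ t in Set.Ioi x, gaussExp t ≤ 2 * gaussExp x := by
  -- Here `p x = 2`, and `exp (x - t) ≥ 1 + x - t` gives `t * p t - p' t ≥ 1`.
  have h := integral_Ioi_gaussExp_of_hasDerivAt (p := fun t => 1 + Real.exp (x - t))
    (p' := fun t => -Real.exp (x - t)) (x := x) (fun t _ => by
      have := (((hasDerivAt_id t).const_sub x).exp).const_add 1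
      simpa using this) (fun t ht => by
      have : x < t := ht
      have := Real.exp_pos (x - t)
      have : 0 ≤ t * (1 + Real.exp (x - t)) := mul_nonneg (by linarith) (by linarith)
      linarith)
    (by
      refine squeeze_zero (g := fun t => (1 + Real.exp x * Real.exp (-t)) * gaussExp t)
        (fun t => by have := gaussExp_pos t; positivity) (fun t => ?_) ?_
      · rw [← Real.exp_add, ← sub_eq_add_neg]
      · have h0 := tendsto_linear_mul_gaussExp 1 0
        simp only [zero_mul, add_zero, one_mul] at h0
        have := ((Real.tendsto_exp_neg_atTop_nhds_zero.const_mul (Real.exp x)).const_add 1).mul h0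
        simpa using this)
  calc _ ≤ ∫ t in Set.Ioi x, (t * (1 + Real.exp (x - t)) - -Real.exp (x - t)) * gaussExp t := by
        refine setIntegral_mono_on integrable_gaussExp.integrableOn h.1 measurableSet_Ioi
          fun t ht => ?_
        have h1 : x < t := ht
        have h2 := Real.add_one_le_exp (x - t)
        have h3 := mul_nonneg (hx.trans h1.le) (Real.exp_pos (x - t)).le
        exact le_mul_of_one_le_left (gaussExp_pos t).le (by linarith)
    _ = 2 * gaussExp x := by rw [h.2, sub_self, Real.exp_zero]; ring

/-- The solution of the Stein equation `f' - x f = h - 𝔼 h`. -/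
def steinSol (h : ℝ → ℝ) (x : ℝ) : ℝ :=
  -(gaussExp x)⁻¹ * ∫ t in Set.Ioi x, (h t - ∫ u, h u ∂(gaussianReal 0 1)) * gaussExp t

/-- The derivative of the solution of the Stein equation. -/
def steinDeriv (h : ℝ → ℝ) (x : ℝ) : ℝ :=
  x * steinSol h x + (h x - ∫ u, h u ∂(gaussianReal 0 1))

lemma integrable_sub_mean_mul_gaussExp {h : ℝ → ℝ} (hh : LipschitzWith 1 h) (m : ℝ) :
    Integrable (fun t => (h t - m) * gaussExp t) := by
  simp_rw [sub_mul]
  exact (integrable_lipschitz_mul_gaussExp hh).sub (integrable_gaussExp.const_mul _)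

lemma hasDerivAt_steinSol {h : ℝ → ℝ} (hh : LipschitzWith 1 h) (x : ℝ) :
    HasDerivAt (steinSol h) (steinDeriv h x) x := by
  set m := ∫ u, h u ∂(gaussianReal 0 1) with hm
  have hi := integrable_sub_mean_mul_gaussExp hh m
  have hc : Continuous (fun t => (h t - m) * gaussExp t) :=
    (hh.continuous.sub continuous_const).mul continuous_gaussExp
  have e : ∀ y, ∫ t in Set.Ioi y, (h t - m) * gaussExp t =
      (∫ t in Set.Ioi 0, (h t - m) * gaussExp t) - ∫ t in (0 : ℝ)..y, (h t - m) * gaussExp t := by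
    intro y
    have := intervalIntegral.integral_interval_add_Ioi (a := 0) (b := y) (μ := volume)
      hi.integrableOn hi.integrableOn
    linarith
  have hd : HasDerivAt (fun y => ∫ t in Set.Ioi y, (h t - m) * gaussExp t)
      (-((h x - m) * gaussExp x)) x := by
    rw [funext e]
    exact (intervalIntegral.integral_hasDerivAt_right (hi.intervalIntegrable)
      (hc.stronglyMeasurableAtFilter _ _) hc.continuousAt).const_sub _
  have hg := ((hasDerivAt_gaussExp x).fun_inv (gaussExp_pos x).ne').fun_neg
  refine (hg.fun_mul hd).congr_deriv ?_
  have := (gaussExp_pos x).ne'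
  simp only [steinDeriv, steinSol, ← hm]
  field_simp

/-- The integrand is at most `(t + 1) * gaussExp t`; its two parts integrate to at most `gaussExp x`
and `2 * gaussExp x`. -/
lemma abs_steinSol_le_of_nonneg {h : ℝ → ℝ} (hh : LipschitzWith 1 h) {x : ℝ} (hx : 0 ≤ x) :
    |steinSol h x| ≤ 3 := by
  set m := ∫ u, h u ∂(gaussianReal 0 1) with hm
  have hi := integral_Ioi_id_mul_gaussExp hx
  have hg := integrable_gaussExp.integrableOn (s := Set.Ioi x)
  have key : |∫ t in Set.Ioi x, (h t - m) * gaussExp t| ≤ 3 * gaussExp x := by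
    calc _ ≤ ∫ t in Set.Ioi x, |(h t - m) * gaussExp t| := abs_integral_le_integral_abs
      _ ≤ ∫ t in Set.Ioi x, (t * gaussExp t + gaussExp t) := by
          refine setIntegral_mono_on (integrable_sub_mean_mul_gaussExp hh m).abs.integrableOn
            (hi.1.add hg) measurableSet_Ioi fun t ht => ?_
          have h1 := abs_sub_mean_le hh t
          rw [abs_of_nonneg (hx.trans (le_of_lt ht))] at h1
          rw [abs_mul, abs_of_pos (gaussExp_pos t)]
          nlinarith [gaussExp_pos t]
      _ ≤ 3 * gaussExp x := by
          rw [integral_add hi.1 hg, hi.2]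
          linarith [integral_Ioi_gaussExp_le hx]
  rw [steinSol, ← hm, abs_mul, abs_neg, abs_inv, abs_of_pos (gaussExp_pos x)]
  rw [inv_mul_le_iff₀ (gaussExp_pos x)]
  linarith

/-- Writing `gaussExp x` as `∫ t * gaussExp t` over `(x, ∞)` puts both terms of the derivative under
one integral, with integrand `((t - x) * (h x - m) - x * (h t - h x)) * gaussExp t`. The
cancellation leaves a factor `t - x`, whose integral is small of order `gaussExp x / (1 + x ^ 2)`.
This decay also controls `x * steinDeriv h x`. -/
lemma abs_steinDeriv_le_of_nonneg {h : ℝ → ℝ} (hh : LipschitzWith 1 h) {x : ℝ} (hx : 0 ≤ x) :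
    (1 + x ^ 2) * |steinDeriv h x| ≤ 2 * x + 1 := by
  set m := ∫ u, h u ∂(gaussianReal 0 1) with hm
  have hi := integral_Ioi_id_mul_gaussExp hx
  have hg := integrable_gaussExp.integrableOn (s := Set.Ioi x)
  have hj : IntegrableOn (fun t => (t - x) * gaussExp t) (Set.Ioi x) := by
    simp_rw [sub_mul]
    exact hi.1.sub (hg.const_mul x)
  have hh1 : IntegrableOn (fun t => x * ((h t - m) * gaussExp t)) (Set.Ioi x) :=
    (integrable_sub_mean_mul_gaussExp hh m).integrableOn.const_mul x
  have e : gaussExp x * steinDeriv h x =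
      ∫ t in Set.Ioi x, ((h x - m) * (t * gaussExp t) - x * ((h t - m) * gaussExp t)) := by
    rw [integral_sub (hi.1.const_mul _) hh1, integral_const_mul, integral_const_mul, hi.2]
    have := (gaussExp_pos x).ne'
    simp only [steinDeriv, steinSol, ← hm]
    field_simp
    ring
  have key : gaussExp x * |steinDeriv h x| ≤
      (2 * x + 1) * ∫ t in Set.Ioi x, (t - x) * gaussExp t := by
    rw [show gaussExp x * |steinDeriv h x| = |gaussExp x * steinDeriv h x| by
      rw [abs_mul, abs_of_pos (gaussExp_pos x)], e]
    refine abs_integral_le_integral_abs.trans ?_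
    rw [← integral_const_mul]
    refine setIntegral_mono_on ((hi.1.const_mul _).sub hh1).abs
      (hj.const_mul _) measurableSet_Ioi fun t ht => ?_
    have h0 : x < t := ht
    have h1 := abs_sub_mean_le hh x
    rw [abs_of_nonneg hx, ← hm] at h1
    have h2 := hh.dist_le_mul t x
    simp only [Real.dist_eq, NNReal.coe_one, one_mul, abs_of_pos (sub_pos.2 h0)] at h2
    have e2 : (h x - m) * (t * gaussExp t) - x * ((h t - m) * gaussExp t) =
      ((t - x) * (h x - m) - x * (h t - h x)) * gaussExp t := by ring
    rw [e2, abs_mul, abs_of_pos (gaussExp_pos t), ← mul_assoc]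
    refine mul_le_mul_of_nonneg_right ?_ (gaussExp_pos t).le
    refine (abs_sub _ _).trans ?_
    rw [abs_mul, abs_mul, abs_of_nonneg hx, abs_of_pos (sub_pos.2 h0)]
    nlinarith [mul_le_mul_of_nonneg_left h1 (sub_pos.2 h0).le, mul_le_mul_of_nonneg_left h2 hx]
  have h3 := integral_Ioi_sub_mul_gaussExp_le hx
  have h4 := gaussExp_pos x
  have h5 : gaussExp x * ((1 + x ^ 2) * |steinDeriv h x|) ≤ gaussExp x * (2 * x + 1) := by
    calc _ = (1 + x ^ 2) * (gaussExp x * |steinDeriv h x|) := by ring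
      _ ≤ (1 + x ^ 2) * ((2 * x + 1) * ∫ t in Set.Ioi x, (t - x) * gaussExp t) := by gcongr
      _ = (2 * x + 1) * ((1 + x ^ 2) * ∫ t in Set.Ioi x, (t - x) * gaussExp t) := by ring
      _ ≤ (2 * x + 1) * gaussExp x := by gcongr
      _ = _ := by ring
  exact le_of_mul_le_mul_left h5 h4

lemma lipschitzWith_comp_neg {h : ℝ → ℝ} (hh : LipschitzWith 1 h) :
    LipschitzWith 1 (fun x => h (-x)) := by
  have := hh.comp (LipschitzWith.id.neg : LipschitzWith 1 (fun x : ℝ => -x))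
  rw [one_mul] at this
  exact this

lemma integral_comp_neg_gaussianReal (h : ℝ → ℝ) :
    ∫ u, h (-u) ∂(gaussianReal 0 1) = ∫ u, h u ∂(gaussianReal 0 1) := by
  rw [integral_gaussianReal_eq, integral_gaussianReal_eq,
    ← integral_neg_eq_self (fun t => h t * gaussExp t)]
  simp [gaussExp_neg]

/-- The centered integrand has total integral zero, so its left and right tails are opposite.
Reflection thus transfers the bounds from `x ≥ 0` to `x ≤ 0`. -/
lemma steinSol_comp_neg {h : ℝ → ℝ} (hh : LipschitzWith 1 h) (x : ℝ) :
    steinSol (fun x => h (-x)) x = -steinSol h (-x) := by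
  have hi := integrable_sub_mean_mul_gaussExp hh (∫ u, h u ∂(gaussianReal 0 1))
  have h1 := intervalIntegral.integral_Iic_add_Ioi (b := -x) hi.integrableOn hi.integrableOn
  rw [integral_sub_mean_mul_gaussExp hh] at h1
  have h2 := integral_comp_neg_Ioi x
    (fun t => (h t - ∫ u, h u ∂(gaussianReal 0 1)) * gaussExp t)
  simp only [gaussExp_neg] at h2
  simp only [steinSol, integral_comp_neg_gaussianReal, h2, gaussExp_neg]
  rw [eq_neg_of_add_eq_zero_left h1]
  ring

lemma steinDeriv_comp_neg {h : ℝ → ℝ} (hh : LipschitzWith 1 h) (x : ℝ) :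
    steinDeriv (fun x => h (-x)) x = steinDeriv h (-x) := by
  simp only [steinDeriv, steinSol_comp_neg hh, integral_comp_neg_gaussianReal]
  ring

lemma abs_steinSol_le {h : ℝ → ℝ} (hh : LipschitzWith 1 h) (x : ℝ) : |steinSol h x| ≤ 3 := by
  rcases le_total 0 x with hx | hx
  · exact abs_steinSol_le_of_nonneg hh hx
  · have := abs_steinSol_le_of_nonneg (lipschitzWith_comp_neg hh) (neg_nonneg.2 hx)
    rwa [steinSol_comp_neg hh, neg_neg, abs_neg] at this

lemma abs_steinDeriv_le' {h : ℝ → ℝ} (hh : LipschitzWith 1 h) (x : ℝ) :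
    (1 + x ^ 2) * |steinDeriv h x| ≤ 2 * |x| + 1 := by
  rcases le_total 0 x with hx | hx
  · rw [abs_of_nonneg hx]; exact abs_steinDeriv_le_of_nonneg hh hx
  · have := abs_steinDeriv_le_of_nonneg (lipschitzWith_comp_neg hh) (neg_nonneg.2 hx)
    rwa [steinDeriv_comp_neg hh, neg_neg, neg_sq, ← abs_of_nonpos hx] at this

lemma abs_steinDeriv_le {h : ℝ → ℝ} (hh : LipschitzWith 1 h) (x : ℝ) : |steinDeriv h x| ≤ 3 := by
  have h1 := abs_steinDeriv_le' hh x
  have h2 : 2 * |x| + 1 ≤ (1 + x ^ 2) * 3 := by nlinarith [sq_nonneg (|x| - 1), sq_abs x]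
  exact le_of_mul_le_mul_left (h1.trans h2) (by positivity)

lemma abs_mul_steinDeriv_le {h : ℝ → ℝ} (hh : LipschitzWith 1 h) (x : ℝ) :
    |x * steinDeriv h x| ≤ 3 := by
  have h1 := mul_le_mul_of_nonneg_left (abs_steinDeriv_le' hh x) (abs_nonneg x)
  have h2 : |x| * (2 * |x| + 1) ≤ (1 + x ^ 2) * 3 := by nlinarith [sq_nonneg (|x| - 1), sq_abs x]
  rw [abs_mul]
  refine le_of_mul_le_mul_left (le_trans ?_ h2) (by positivity : 0 < 1 + x ^ 2)
  linarith

/-- No second derivative of the solution `f` is needed: `f'` is `x * f` plus a translate of `h`, and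
`(x * f)' = f + x * f'` is bounded by `3 + 3`; the Lipschitz constant of `h` adds `1`. -/
lemma abs_steinDeriv_sub_le {h : ℝ → ℝ} (hh : LipschitzWith 1 h) (x y : ℝ) :
    |steinDeriv h x - steinDeriv h y| ≤ 7 * |x - y| := by
  have hd : ∀ z, HasDerivAt (fun z => z * steinSol h z) (steinSol h z + z * steinDeriv h z) z := by
    intro z
    have := (hasDerivAt_id z).fun_mul (hasDerivAt_steinSol hh z)
    simpa using this
  have h1 : |x * steinSol h x - y * steinSol h y| ≤ 6 * |x - y| := by
    have := Convex.norm_image_sub_le_of_norm_hasDerivWithin_le (s := Set.univ) (C := 6)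
      (x := y) (y := x) (fun z _ => (hd z).hasDerivWithinAt) (fun z _ => ?_) convex_univ
      (Set.mem_univ _) (Set.mem_univ _)
    · simpa using this
    · refine (abs_add_le _ _).trans ?_
      linarith [abs_steinSol_le hh z, abs_mul_steinDeriv_le hh z]
  have h2 := hh.dist_le_mul x y
  simp only [Real.dist_eq, NNReal.coe_one, one_mul] at h2
  have e : steinDeriv h x - steinDeriv h y =
      (x * steinSol h x - y * steinSol h y) + (h x - h y) := by
    simp only [steinDeriv]; ring
  rw [e]
  refine (abs_add_le _ _).trans ?_
  linarith

lemma abs_steinSol_sub_sub_le {h : ℝ → ℝ} (hh : LipschitzWith 1 h) (x y : ℝ) :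
    |steinSol h x - steinSol h y - steinDeriv h x * (x - y)| ≤ 7 * (x - y) ^ 2 := by
  have hd : ∀ z, HasDerivAt (fun z => steinSol h z - steinDeriv h x * z)
      (steinDeriv h z - steinDeriv h x) z := by
    intro z
    have := (hasDerivAt_steinSol hh z).fun_sub ((hasDerivAt_id z).const_mul (steinDeriv h x))
    simpa using this
  have := Convex.norm_image_sub_le_of_norm_hasDerivWithin_le (s := Set.uIcc y x)
    (C := 7 * |x - y|) (x := y) (y := x) (fun z _ => (hd z).hasDerivWithinAt) (fun z hz => ?_)
    (convex_uIcc y x) Set.left_mem_uIcc Set.right_mem_uIcc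
  · simp only [Real.norm_eq_abs] at this
    rw [mul_assoc, abs_mul_abs_self] at this
    convert this using 2 <;> ring
  · refine (abs_steinDeriv_sub_le hh z x).trans ?_
    have : |z - x| ≤ |x - y| := by
      rw [abs_sub_comm z x]
      exact Set.abs_sub_right_of_mem_uIcc hz
    linarith

/-! ### Averages over colorings and Stein's bound for functions of independent colors -/

section Average

variable {V κ : Type*} [Fintype V] [DecidableEq V] [Fintype κ]

/-- The mean of `F` over all colorings. -/
def avg (F : (V → κ) → ℝ) : ℝ := Finset.univ.expect F

/-- The conditional mean of `F` when the colors of the vertices in `P` are resampled. -/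
def avgOn (P : Finset V) (F : (V → κ) → ℝ) (X : V → κ) : ℝ :=
  avg fun Y => F (P.piecewise Y X)

lemma avg_add (F G : (V → κ) → ℝ) : avg (fun X => F X + G X) = avg F + avg G :=
  Finset.expect_add_distrib _ _ _

lemma avg_sub (F G : (V → κ) → ℝ) : avg (fun X => F X - G X) = avg F - avg G :=
  Finset.expect_sub_distrib _ _ _

lemma avg_neg (F : (V → κ) → ℝ) : avg (fun X => - F X) = - avg F :=
  Finset.expect_neg_distrib _ _

lemma avg_const_mul (a : ℝ) (F : (V → κ) → ℝ) : avg (fun X => a * F X) = a * avg F :=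
  (Finset.mul_expect _ _ _).symm

lemma avg_mul_const (a : ℝ) (F : (V → κ) → ℝ) : avg (fun X => F X * a) = avg F * a :=
  (Finset.expect_mul _ _ _).symm

lemma avg_div_const (a : ℝ) (F : (V → κ) → ℝ) : avg (fun X => F X / a) = avg F / a :=
  (Finset.expect_div _ _ _).symm

lemma avg_sum {ι : Type*} (s : Finset ι) (F : ι → (V → κ) → ℝ) :
    avg (fun X => ∑ i ∈ s, F i X) = ∑ i ∈ s, avg (F i) :=
  Finset.expect_sum_comm _ _ _

lemma avg_mono {F G : (V → κ) → ℝ} (h : ∀ X, F X ≤ G X) : avg F ≤ avg G :=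
  Finset.expect_le_expect fun X _ => h X

lemma avg_nonneg {F : (V → κ) → ℝ} (h : ∀ X, 0 ≤ F X) : 0 ≤ avg F :=
  Finset.expect_nonneg fun X _ => h X

lemma abs_avg_le (F : (V → κ) → ℝ) : |avg F| ≤ avg fun X => |F X| :=
  Finset.abs_expect_le _ _

@[simp] lemma avg_zero : avg (fun _ : V → κ => 0) = 0 := Finset.expect_const_zero _

@[simp] lemma avg_const [Nonempty κ] (a : ℝ) : avg (fun _ : V → κ => a) = a :=
  Finset.expect_const Finset.univ_nonempty a

lemma avg_comp_equiv (e : (V → κ) ≃ (V → κ)) (F : (V → κ) → ℝ) :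
    avg (fun X => F (e X)) = avg F :=
  Fintype.expect_equiv e _ _ fun _ => rfl

lemma avg_avgOn [Nonempty κ] (P : Finset V) (F : (V → κ) → ℝ) : avg (avgOn P F) = avg F := by
  -- Exchanging the coordinates in `P` between two independent colorings is an involution, so the
  -- resampled coloring is again uniform.
  let e : (V → κ) × (V → κ) ≃ (V → κ) × (V → κ) :=
    { toFun := fun p => (P.piecewise p.2 p.1, P.piecewise p.1 p.2)
      invFun := fun p => (P.piecewise p.2 p.1, P.piecewise p.1 p.2)
      left_inv := fun p => by
        ext v <;> by_cases hv : v ∈ P <;> simp [hv]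
      right_inv := fun p => by
        ext v <;> by_cases hv : v ∈ P <;> simp [hv] }
  have h1 : avg (avgOn P F) = (Finset.univ ×ˢ Finset.univ).expect
      fun p : (V → κ) × (V → κ) => F (e p).1 := by
    rw [Finset.expect_product]; rfl
  have h2 : avg F = (Finset.univ ×ˢ Finset.univ).expect
      fun p : (V → κ) × (V → κ) => F p.1 := by
    rw [Finset.expect_product]
    simp only [Finset.expect_const Finset.univ_nonempty]
    rfl
  rw [h1, h2, Finset.univ_product_univ]
  exact Fintype.expect_equiv e _ _ fun _ => rfl

lemma piecewise_agree {V κ : Type*} [DecidableEq V] {P : Finset V} {X Y : V → κ} {v : V} (hv : v ∉ P) :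
    P.piecewise Y X v = X v := by simp [hv]

lemma avgOn_mul_left {P : Finset V} {G : (V → κ) → ℝ} (hG : DependsOn G ((P : Set V)ᶜ))
    (F : (V → κ) → ℝ) (X : V → κ) :
    avgOn P (fun X => G X * F X) X = G X * avgOn P F X := by
  simp only [avgOn, ← avg_const_mul]
  congr 1 with Y
  rw [hG (x := P.piecewise Y X) (y := X) fun v hv => piecewise_agree (by simpa using hv)]

lemma avg_mul_avgOn [Nonempty κ] {P : Finset V} {G : (V → κ) → ℝ}
    (hG : DependsOn G ((P : Set V)ᶜ)) (F : (V → κ) → ℝ) :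
    avg (fun X => G X * avgOn P F X) = avg (fun X => G X * F X) := by
  simp only [← avgOn_mul_left hG]
  exact avg_avgOn _ _

lemma avg_mul_eq_zero [Nonempty κ] {P : Finset V} {G : (V → κ) → ℝ}
    (hG : DependsOn G ((P : Set V)ᶜ)) {F : (V → κ) → ℝ} (hF : ∀ X, avgOn P F X = 0) :
    avg (fun X => F X * G X) = 0 := by
  simp only [mul_comm]
  rw [← avg_mul_avgOn hG]
  simp [hF]

lemma dependsOn_avgOn (P : Finset V) (F : (V → κ) → ℝ) :
    DependsOn (avgOn P F) ((P : Set V)ᶜ) := by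
  intro X X' h
  unfold avgOn
  congr 1 with Y
  congr 1
  ext v
  by_cases hv : v ∈ P
  · simp [hv]
  · simp [hv, h v (by simpa using hv)]

lemma avgOn_sub (P : Finset V) (F G : (V → κ) → ℝ) (X : V → κ) :
    avgOn P (fun X => F X - G X) X = avgOn P F X - avgOn P G X := avg_sub _ _

lemma avgOn_sum {ι : Type*} (s : Finset ι) (P : Finset V) (F : ι → (V → κ) → ℝ) (X : V → κ) :
    avgOn P (fun X => ∑ i ∈ s, F i X) X = ∑ i ∈ s, avgOn P (F i) X := avg_sum _ _

lemma avgOn_const_mul (P : Finset V) (a : ℝ) (F : (V → κ) → ℝ) (X : V → κ) :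
    avgOn P (fun X => a * F X) X = a * avgOn P F X := avg_const_mul _ _

lemma avgOn_of_dependsOn [Nonempty κ] {P : Finset V} {F : (V → κ) → ℝ}
    (hF : DependsOn F ((P : Set V)ᶜ)) (X : V → κ) : avgOn P F X = F X := by
  have : (fun Y => F (P.piecewise Y X)) = fun _ => F X := by
    ext Y
    exact hF fun v hv => piecewise_agree (by simpa using hv)
  rw [avgOn, this, avg_const]

/-- Invariance under permutations of the colors makes two functions uncorrelated as soon as they
have at most one vertex in common. -/
lemma avg_mul_of_invariant [DecidableEq κ] [Nonempty κ] {F G : (V → κ) → ℝ} {D E : Finset V}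
    (hF : DependsOn F (D : Set V)) (hG : DependsOn G (E : Set V))
    (hinv : ∀ (π : Equiv.Perm κ) X, F (π ∘ X) = F X) (hDE : (D ∩ E).card ≤ 1) :
    avg (fun X => F X * G X) = avg F * avg G := by
  -- Resampling the vertices private to `F` leaves a function of at most one color. A permutation of
  -- the colors carries any value of it to any other, so this function is constant, equal to `avg
  -- F`.
  set P := D \ E with hP
  have hG' : DependsOn G ((P : Set V)ᶜ) := hG.mono fun v hv => by
    simp only [Set.mem_compl_iff, Finset.mem_coe, hP, Finset.mem_sdiff, not_and, not_not]
    exact fun _ => hv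
  have hc : ∀ X X', avgOn P F X = avgOn P F X' := by
    intro X X'
    obtain ⟨π, hπ⟩ : ∃ π : Equiv.Perm κ, ∀ v ∈ D ∩ E, π (X v) = X' v := by
      rcases Finset.eq_empty_or_nonempty (D ∩ E) with h0 | ⟨w, hw⟩
      · exact ⟨1, by simp [h0]⟩
      · refine ⟨Equiv.swap (X w) (X' w), fun v hv => ?_⟩
        rw [Finset.card_le_one.1 hDE v hv w hw, Equiv.swap_apply_left]
    have e : ∀ Y, F (P.piecewise Y X) = F (P.piecewise (π ∘ Y) X') := by
      intro Y
      rw [← hinv π]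
      refine hF fun v hv => ?_
      by_cases hvP : v ∈ P
      · simp [hvP]
      · have hvE : v ∈ D ∩ E := by
          simp only [hP, Finset.mem_sdiff, not_and, not_not] at hvP
          exact Finset.mem_inter.2 ⟨hv, hvP hv⟩
        simp [hvP, hπ v hvE]
    simp only [avgOn, e]
    exact avg_comp_equiv (Equiv.piCongrRight fun _ => π) (fun Y => F (P.piecewise Y X'))
  have hc' : ∀ X, avgOn P F X = avg F := by
    intro X
    rw [← avg_avgOn P F]
    have : avgOn P F = fun _ => avgOn P F X := by ext X'; exact hc _ _
    rw [this, avg_const]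
  calc avg (fun X => F X * G X) = avg (fun X => G X * F X) := by simp only [mul_comm]
    _ = avg (fun X => G X * avgOn P F X) := (avg_mul_avgOn hG' F).symm
    _ = avg F * avg G := by simp only [hc', avg_mul_const]; ring

/-- The probability that the vertices in `P` all have a given color. -/
lemma avg_forall_eq [DecidableEq κ] [Nonempty κ] (P : Finset V) (k : κ) :
    avg (fun Y : V → κ => if ∀ v ∈ P, Y v = k then (1 : ℝ) else 0) =
      ((Fintype.card κ : ℝ) ^ P.card)⁻¹ := by
  rw [avg, Fintype.expect_eq_sum_div_card, Finset.sum_boole]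
  have h : (Finset.univ.filter fun Y : V → κ => ∀ v ∈ P, Y v = k) =
      Fintype.piFinset fun v => if v ∈ P then {k} else Finset.univ := by
    ext Y
    simp only [Finset.mem_filter, Finset.mem_univ, true_and, Fintype.mem_piFinset]
    refine forall_congr' fun v => ?_
    by_cases hv : v ∈ P <;> simp [hv]
  have h2 : ∏ v : V, (if v ∈ P then ({k} : Finset κ) else Finset.univ).card =
      Fintype.card κ ^ (Finset.univ \ P).card := by
    rw [← Finset.prod_sdiff (Finset.subset_univ P)]
    rw [Finset.prod_congr rfl (g := fun _ => Fintype.card κ) fun v hv => by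
      simp [(Finset.mem_sdiff.1 hv).2, Finset.card_univ]]
    rw [Finset.prod_congr (s₁ := P) rfl (g := fun _ => 1) fun v hv => by simp [hv]]
    simp
  have hk : (Fintype.card κ : ℝ) ≠ 0 := by exact_mod_cast Fintype.card_ne_zero
  rw [h, Fintype.card_piFinset, h2, Fintype.card_fun, ← Finset.card_univ (α := V),
    ← Finset.card_sdiff_add_card_eq_card (Finset.subset_univ P)]
  push_cast
  rw [pow_add]
  field_simp

/-- The colors of the vertices in `P` agree with that of a vertex `w` outside `P` with probability
`c ^ (-|P|)`, whatever the color of `w` is. -/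
lemma avgOn_forall_eq [DecidableEq κ] [Nonempty κ] {P : Finset V} {w : V} (hw : w ∉ P)
    (X : V → κ) :
    avgOn P (fun X => if ∀ v ∈ P, X v = X w then (1 : ℝ) else 0) X =
      ((Fintype.card κ : ℝ) ^ P.card)⁻¹ := by
  rw [← avg_forall_eq P (X w), avgOn]
  congr 1 with Y
  congr 1
  simp only [Finset.piecewise_eq_of_notMem _ _ _ hw]
  refine propext (forall₂_congr fun v hv => ?_)
  rw [Finset.piecewise_eq_of_mem _ _ _ hv]

/-- If `F` does not depend on the vertices in `P`, then the vertices in `P` take the color of a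
given vertex outside `P` independently of `F`. -/
lemma avg_mul_forall_eq [DecidableEq κ] [Nonempty κ] {P : Finset V} {w : V} (hw : w ∉ P)
    {F : (V → κ) → ℝ} (hF : DependsOn F ((P : Set V)ᶜ)) :
    avg (fun X => F X * if ∀ v ∈ P, X v = X w then (1 : ℝ) else 0) =
      avg F * ((Fintype.card κ : ℝ) ^ P.card)⁻¹ := by
  rw [← avg_mul_avgOn hF, ← avg_mul_const]
  simp only [avgOn_forall_eq hw]

/-- Normal approximation for a function of independent colors, by Stein's method. -/
lemma abs_avg_sub_integral_le [Nonempty κ] {T : (V → κ) → ℝ} {sd : ℝ} (hsd : 0 < sd)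
    {A R : V → (V → κ) → ℝ} (hA : ∀ j X, avgOn {j} (A j) X = 0)
    (hsum : ∀ X, ∑ j, A j X = T X - avg T) (hR : ∀ j X, R j X = T X - avgOn {j} T X)
    {h : ℝ → ℝ} (hh : LipschitzWith 1 h) :
    |avg (fun X => h ((T X - avg T) / sd)) - ∫ t, h t ∂(gaussianReal 0 1)| ≤
      3 * avg (fun X => |1 - (∑ j, A j X * R j X) / sd ^ 2|) +
        7 * avg (fun X => ∑ j, |A j X| * R j X ^ 2) / sd ^ 3 := by
  set W : (V → κ) → ℝ := fun X => (T X - avg T) / sd with hW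
  set U : V → (V → κ) → ℝ := fun j X => (avgOn {j} T X - avg T) / sd with hU
  have hWU : ∀ j X, W X - U j X = R j X / sd := fun j X => by
    simp only [hW, hU, hR]; ring
  have hzero : ∀ j, avg (fun X => A j X * steinSol h (U j X)) = 0 := fun j => by
    refine avg_mul_eq_zero (P := {j}) (fun X X' hX => ?_) (hA j)
    simp only [hU]
    rw [dependsOn_avgOn {j} T hX]
  have e : avg (fun X => h (W X)) - ∫ t, h t ∂(gaussianReal 0 1) =
      avg (fun X => steinDeriv h (W X) * (1 - (∑ j, A j X * R j X) / sd ^ 2) -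
        ∑ j, A j X / sd * (steinSol h (W X) - steinSol h (U j X) -
          steinDeriv h (W X) * (W X - U j X))) := by
    have e1 : avg (fun X => h (W X)) - ∫ t, h t ∂(gaussianReal 0 1) =
        avg (fun X => h (W X) - ∫ t, h t ∂(gaussianReal 0 1)) := by
      rw [avg_sub, avg_const]
    -- `U j` ignores the color of `j`, over which `A j` averages to zero. Adding this zero replaces
    -- `f (W)` by the differences `f (W) - f (U j)` in the expansion of `W * f (W)`.
    have e2 : avg (fun X => ∑ j, A j X * steinSol h (U j X) / sd) = 0 := by
      rw [avg_sum]
      simp only [avg_div_const, hzero, zero_div, Finset.sum_const_zero]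
    rw [e1]
    refine (add_zero _).symm.trans ((congrArg (_ + ·) e2.symm).trans ?_)
    rw [← avg_add]
    congr 1 with X
    have e3 : h (W X) - ∫ t, h t ∂(gaussianReal 0 1) =
        steinDeriv h (W X) - (∑ j, A j X) / sd * steinSol h (W X) := by
      rw [hsum]; simp only [steinDeriv, hW]; ring
    rw [e3]
    simp only [hWU, Finset.sum_div, Finset.sum_mul, mul_sub, Finset.mul_sum, mul_one,
      Finset.sum_sub_distrib]
    have e4 : ∀ j, A j X / sd * (steinDeriv h (W X) * (R j X / sd)) =
        steinDeriv h (W X) * (A j X * R j X / sd ^ 2) := fun j => by field_simp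
    have e5 : ∀ j, A j X / sd * steinSol h (U j X) = A j X * steinSol h (U j X) / sd :=
      fun j => by ring
    simp only [e4, e5]
    ring
  rw [e]
  refine (abs_avg_le _).trans ?_
  have e6 : 3 * avg (fun X => |1 - (∑ j, A j X * R j X) / sd ^ 2|) +
      7 * avg (fun X => ∑ j, |A j X| * R j X ^ 2) / sd ^ 3 =
      avg (fun X => 3 * |1 - (∑ j, A j X * R j X) / sd ^ 2| +
        7 * (∑ j, |A j X| * R j X ^ 2) / sd ^ 3) := by
    rw [avg_add, avg_const_mul, avg_div_const, avg_const_mul]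
  rw [e6]
  refine avg_mono fun X => ?_
  refine (abs_sub _ _).trans (add_le_add ?_ ?_)
  · rw [abs_mul]
    exact mul_le_mul_of_nonneg_right (abs_steinDeriv_le hh _) (abs_nonneg _)
  · refine (Finset.abs_sum_le_sum_abs _ _).trans ?_
    rw [Finset.mul_sum, Finset.sum_div]
    refine Finset.sum_le_sum fun j _ => ?_
    rw [abs_mul, abs_div, abs_of_pos hsd]
    have := abs_steinSol_sub_sub_le hh (W X) (U j X)
    calc _ ≤ |A j X| / sd * (7 * (W X - U j X) ^ 2) :=
          mul_le_mul_of_nonneg_left this (by positivity)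
      _ = _ := by rw [hWU]; field_simp

/-- Each `A j` is orthogonal to `avgOn {j} T`, so `R j` may be replaced by `T - avg T`, and the `A
j` sum to the same quantity. Thus `∑ A j R j / σ²` has mean `1`, and its distance from `1` is a
matter of variance. -/
lemma avg_sum_mul_sub_avgOn [Nonempty κ] {T : (V → κ) → ℝ}
    {A R : V → (V → κ) → ℝ} (hA : ∀ j X, avgOn {j} (A j) X = 0)
    (hsum : ∀ X, ∑ j, A j X = T X - avg T) (hR : ∀ j X, R j X = T X - avgOn {j} T X) :
    avg (fun X => ∑ j, A j X * R j X) = avg (fun X => (T X - avg T) ^ 2) := by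
  have h1 : ∀ j, avg (fun X => A j X * R j X) = avg (fun X => A j X * (T X - avg T)) := by
    intro j
    have h0 : avg (fun X => A j X * (avgOn {j} T X - avg T)) = 0 :=
      avg_mul_eq_zero (P := {j}) (fun X X' hX => by
        rw [dependsOn_avgOn {j} T hX]) (hA j)
    rw [← sub_eq_zero, ← avg_sub, ← neg_eq_zero, ← avg_neg, ← h0]
    congr 1 with X
    rw [hR]; ring
  rw [avg_sum]
  simp only [h1]
  rw [← avg_sum]
  simp only [← Finset.sum_mul, hsum, sq]

/-- Stein's bound when the second and fourth moments of the increments are under control. -/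
lemma abs_avg_sub_integral_le_of_moments [Nonempty κ] {T : (V → κ) → ℝ} {sd : ℝ} (hsd : 0 < sd)
    {A R : V → (V → κ) → ℝ} (hA : ∀ j X, avgOn {j} (A j) X = 0)
    (hsum : ∀ X, ∑ j, A j X = T X - avg T) (hR : ∀ j X, R j X = T X - avgOn {j} T X)
    (hvar : avg (fun X => (T X - avg T) ^ 2) = sd ^ 2) {K η : ℝ} (hη : 0 < η)
    (h2 : ∑ j, avg (fun X => A j X ^ 2) ≤ K * sd ^ 2)
    (h4 : ∑ j, avg (fun X => R j X ^ 4) ≤ K * sd ^ 4 * η ^ 2)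
    (hQ : avg (fun X => (∑ j, A j X * R j X - avg (fun X => ∑ j, A j X * R j X)) ^ 2) ≤
      K * sd ^ 4 * η ^ 2)
    {h : ℝ → ℝ} (hh : LipschitzWith 1 h) :
    |avg (fun X => h ((T X - avg T) / sd)) - ∫ t, h t ∂(gaussianReal 0 1)| ≤
      (2 + 9 * K) * η := by
  refine (abs_avg_sub_integral_le hsd hA hsum hR hh).trans ?_
  have hK : 0 ≤ K := by
    have h0 : 0 ≤ K * sd ^ 2 := le_trans
      (Finset.sum_nonneg fun j _ => avg_nonneg fun X => sq_nonneg _) h2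
    exact nonneg_of_mul_nonneg_left h0 (by positivity)
  rw [avg_sum_mul_sub_avgOn hA hsum hR, hvar] at hQ
  have b1 : avg (fun X => |1 - (∑ j, A j X * R j X) / sd ^ 2|) ≤ (1 + K) * η / 2 := by
    -- `|q| ≤ η / 2 + q ^ 2 / (2 * η)`: this weighted inequality replaces Cauchy–Schwarz, with `η`
    -- the order of the final bound.
    have p : ∀ X, |1 - (∑ j, A j X * R j X) / sd ^ 2| ≤
        η / 2 + 1 / (2 * η * sd ^ 4) * (∑ j, A j X * R j X - sd ^ 2) ^ 2 := by
      intro X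
      set q := 1 - (∑ j, A j X * R j X) / sd ^ 2 with hq
      have e : 1 / (2 * η * sd ^ 4) * (∑ j, A j X * R j X - sd ^ 2) ^ 2 = q ^ 2 / (2 * η) := by
        rw [hq]; field_simp; ring
      rw [e, ← sub_nonneg]
      have e2 : η / 2 + q ^ 2 / (2 * η) - |q| = (η - |q|) ^ 2 / (2 * η) := by
        rw [← sq_abs q]; field_simp; ring
      rw [e2]; positivity
    refine (avg_mono p).trans ?_
    rw [avg_add, avg_const, avg_const_mul]
    have : 1 / (2 * η * sd ^ 4) * avg (fun X => (∑ j, A j X * R j X - sd ^ 2) ^ 2) ≤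
        1 / (2 * η * sd ^ 4) * (K * sd ^ 4 * η ^ 2) :=
      mul_le_mul_of_nonneg_left hQ (by positivity)
    refine (add_le_add le_rfl this).trans (le_of_eq ?_)
    field_simp
  have b2 : avg (fun X => ∑ j, |A j X| * R j X ^ 2) ≤ K * sd ^ 3 * η := by
    -- The weights of `A j ^ 2` and `R j ^ 4` are chosen so that both sums end up as `K * sd ^ 3 * η
    -- / 2`.
    have p : ∀ X, ∑ j, |A j X| * R j X ^ 2 ≤
        ∑ j, (sd * η / 2 * A j X ^ 2 + 1 / (2 * sd * η) * R j X ^ 4) := by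
      refine fun X => Finset.sum_le_sum fun j _ => ?_
      rw [← sub_nonneg]
      have e2 : sd * η / 2 * A j X ^ 2 + 1 / (2 * sd * η) * R j X ^ 4 - |A j X| * R j X ^ 2 =
          (sd * η * |A j X| - R j X ^ 2) ^ 2 / (2 * sd * η) := by
        rw [← sq_abs (A j X)]; field_simp; ring
      rw [e2]; positivity
    refine (avg_mono p).trans ?_
    rw [avg_sum]
    simp only [avg_add, avg_const_mul, Finset.sum_add_distrib, ← Finset.mul_sum]
    have q1 := mul_le_mul_of_nonneg_left h2 (by positivity : 0 ≤ sd * η / 2)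
    have q2 := mul_le_mul_of_nonneg_left h4 (by positivity : 0 ≤ 1 / (2 * sd * η))
    refine (add_le_add q1 q2).trans (le_of_eq ?_)
    field_simp
    ring
  have b3 : 7 * avg (fun X => ∑ j, |A j X| * R j X ^ 2) / sd ^ 3 ≤ 7 * K * η := by
    rw [div_le_iff₀ (by positivity)]
    nlinarith
  nlinarith [mul_nonneg hK hη.le]

end Average

/-! ### Revealing the colors of one tuple -/

section Monochromatic

variable {V κ : Type*} [Fintype V] [DecidableEq V] [Fintype κ] [DecidableEq κ] {r : ℕ}

/-- The conditional probability that the tuple `s` is monochromatic, given the colors of the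
entries with index in `α`. -/
def condMono (s : Fin r ↪ V) (α : Finset (Fin r)) (X : V → κ) : ℝ :=
  (Fintype.card κ : ℝ) ^ (α.card - 1) / (Fintype.card κ : ℝ) ^ (r - 1) *
    if ∀ i ∈ α, ∀ j ∈ α, X (s i) = X (s j) then 1 else 0

/-- The change of the conditional probability that `s` is monochromatic when the color of the entry
with index `i` is revealed after those with index in `α`. -/
def monoIncr (s : Fin r ↪ V) (i : Fin r) (α : Finset (Fin r)) (X : V → κ) : ℝ :=
  condMono s (insert i α) X - condMono s α X

/-- The set of entries of a tuple. -/
def supp {V : Type*} (s : Fin r ↪ V) : Finset V := Finset.univ.map s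

omit [Fintype V] [DecidableEq V] in
lemma condMono_nonneg (s : Fin r ↪ V) (α : Finset (Fin r)) (X : V → κ) : 0 ≤ condMono s α X := by
  unfold condMono; positivity

lemma card_supp {V : Type*} (s : Fin r ↪ V) : (supp s).card = r := by simp [supp]

lemma mem_supp {V : Type*} (s : Fin r ↪ V) (i : Fin r) : s i ∈ supp s := by simp [supp]

omit [Fintype V] [DecidableEq V] in
lemma condMono_congr (s : Fin r ↪ V) (α : Finset (Fin r)) {X Y : V → κ}
    (h : ∀ i ∈ α, X (s i) = Y (s i)) : condMono s α X = condMono s α Y := by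
  unfold condMono
  congr 2
  refine propext (forall₂_congr fun i hi => forall₂_congr fun j hj => ?_)
  rw [h i hi, h j hj]

omit [Fintype V] [DecidableEq V] in
lemma dependsOn_monoIncr (s : Fin r ↪ V) (i : Fin r) (α : Finset (Fin r)) :
    DependsOn (monoIncr s i α : (V → κ) → ℝ) (supp s : Set V) := fun X Y h => by
  have h' : ∀ j, X (s j) = Y (s j) := fun j => h (s j) (mem_supp s j)
  unfold monoIncr
  rw [condMono_congr s _ fun j _ => h' j, condMono_congr s α fun j _ => h' j]

omit [Fintype V] [DecidableEq V] in
lemma monoIncr_comp_perm (s : Fin r ↪ V) (i : Fin r) (α : Finset (Fin r)) (π : Equiv.Perm κ)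
    (X : V → κ) : monoIncr s i α (π ∘ X) = monoIncr s i α X := by
  simp [monoIncr, condMono]

variable [Nonempty κ]

/-- The martingale property: a newly revealed vertex takes the common color with probability `1 /
c`, which the normalization of `condMono` compensates. -/
lemma avgOn_condMono_insert (s : Fin r ↪ V) {i : Fin r} {α : Finset (Fin r)} (hi : i ∉ α)
    (X : V → κ) : avgOn {s i} (condMono s (insert i α)) X = condMono s α X := by
  have hk : (Fintype.card κ : ℝ) ≠ 0 := by exact_mod_cast Fintype.card_ne_zero
  -- The truncated exponent `α.card - 1` is `0` for empty and for one-element `α`: the first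
  -- revealed color carries no information.
  rcases α.eq_empty_or_nonempty with rfl | ⟨a, ha⟩
  · have : ∀ X : V → κ, condMono s (insert i ∅) X = condMono s ∅ X := by
      intro X; simp [condMono]
    rw [show condMono s (insert i ∅) = fun X : V → κ => condMono s ∅ X from funext this]
    exact avgOn_of_dependsOn (fun Y Z _ => condMono_congr s _ (by simp)) X
  · have hne : ∀ j ∈ α, s j ≠ s i := fun j hj h => hi (s.injective h ▸ hj)
    have e : ∀ Y : V → κ, condMono s (insert i α) Y = (Fintype.card κ : ℝ) * (condMono s α Y *
        if ∀ v ∈ ({s i} : Finset V), Y v = Y (s a) then (1 : ℝ) else 0) := by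
      intro Y
      have hc : α.card = α.card - 1 + 1 := by have := Finset.card_pos.2 ⟨a, ha⟩; omega
      simp only [condMono, Finset.card_insert_of_notMem hi, Nat.add_sub_cancel,
        Finset.mem_singleton, forall_eq]
      have hiff : (∀ k ∈ insert i α, ∀ j ∈ insert i α, Y (s k) = Y (s j)) ↔
          (∀ k ∈ α, ∀ j ∈ α, Y (s k) = Y (s j)) ∧ Y (s i) = Y (s a) := by
        constructor
        · intro h
          exact ⟨fun k hk j hj => h k (Finset.mem_insert_of_mem hk) j (Finset.mem_insert_of_mem hj),
            h i (Finset.mem_insert_self _ _) a (Finset.mem_insert_of_mem ha)⟩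
        · rintro ⟨h1, h2⟩
          have h3 : ∀ k ∈ insert i α, Y (s k) = Y (s a) := by
            intro k hk
            rcases Finset.mem_insert.1 hk with rfl | hk
            · exact h2
            · exact h1 k hk a ha
          exact fun k hk j hj => (h3 k hk).trans (h3 j hj).symm
      rw [if_congr hiff rfl rfl, ite_and]
      conv_lhs => rw [hc, pow_succ]
      split_ifs <;> ring
    rw [show condMono s (insert i α) = fun Y : V → κ => _ from funext e, avgOn_const_mul,
      avgOn_mul_left, avgOn_forall_eq]
    · simp only [Finset.card_singleton, pow_one]
      field_simp
    · simpa using hne a ha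
    · refine fun Y Z h => condMono_congr s _ fun j hj => h _ ?_
      simpa using hne j hj

lemma avgOn_monoIncr (s : Fin r ↪ V) {i : Fin r} {α : Finset (Fin r)} (hi : i ∉ α) (X : V → κ) :
    avgOn {s i} (monoIncr s i α) X = 0 := by
  unfold monoIncr
  rw [avgOn_sub, avgOn_condMono_insert s hi, avgOn_of_dependsOn, sub_self]
  refine fun Y Z h => condMono_congr s _ fun j hj => h _ ?_
  have : s j ≠ s i := fun h => hi (s.injective h ▸ hj)
  simpa using this

/-- Each new vertex of a tuple that meets the support of `F` costs a factor `1 / c`. -/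
lemma avg_mul_condMono_le (s : Fin r ↪ V) (α : Finset (Fin r)) {F : (V → κ) → ℝ}
    (hF0 : ∀ X, 0 ≤ F X) {D : Finset V} (hF : DependsOn F (D : Set V))
    (hD : (supp s ∩ D).Nonempty) :
    avg (fun X => F X * condMono s α X) ≤
      avg F * ((Fintype.card κ : ℝ) ^ (supp s \ D).card)⁻¹ := by
  have hk : 1 ≤ (Fintype.card κ : ℝ) := by exact_mod_cast Fintype.card_pos
  have hk0 : 0 < (Fintype.card κ : ℝ) := by linarith
  have hq : (supp s \ D).card ≤ r - 1 := by
    have h1 := Finset.card_sdiff_add_card_inter (supp s) D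
    have := Finset.card_pos.2 hD
    rw [card_supp] at h1
    omega
  -- a pivot `w` and the set `P` of vertices that have to follow it
  have main : ∀ (P : Finset V) (w : V), w ∉ P → Disjoint P D →
      (∀ v ∈ insert w P, v ∈ α.map s) → (supp s \ D).card + (α.card - 1) ≤ P.card + (r - 1) →
      avg (fun X => F X * condMono s α X) ≤
        avg F * ((Fintype.card κ : ℝ) ^ (supp s \ D).card)⁻¹ := by
    intro P w hw hPD hP hcard
    have hFP : DependsOn F ((P : Set V)ᶜ) := hF.mono fun v hv hvP =>
      Finset.disjoint_left.1 hPD hvP hv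
    set b := (Fintype.card κ : ℝ) ^ (α.card - 1) / (Fintype.card κ : ℝ) ^ (r - 1) with hb
    have h1 : ∀ X, F X * condMono s α X ≤
        b * (F X * if ∀ v ∈ P, X v = X w then (1 : ℝ) else 0) := by
      intro X
      have h2 : condMono s α X ≤ b * if ∀ v ∈ P, X v = X w then (1 : ℝ) else 0 := by
        refine mul_le_mul_of_nonneg_left ?_ (by positivity)
        by_cases h : ∀ i ∈ α, ∀ j ∈ α, X (s i) = X (s j)
        · have h' : ∀ v ∈ P, X v = X w := by
            intro v hv
            obtain ⟨i, hi, rfl⟩ := Finset.mem_map.1 (hP v (Finset.mem_insert_of_mem hv))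
            obtain ⟨j, hj, rfl⟩ := Finset.mem_map.1 (hP w (Finset.mem_insert_self _ _))
            exact h i hi j hj
          rw [if_pos h, if_pos h']
        · rw [if_neg h]; positivity
      calc _ ≤ F X * (b * if ∀ v ∈ P, X v = X w then (1 : ℝ) else 0) :=
            mul_le_mul_of_nonneg_left h2 (hF0 X)
        _ = _ := by ring
    refine (avg_mono h1).trans ?_
    rw [avg_const_mul, avg_mul_forall_eq hw hFP]
    have h3 : b * ((Fintype.card κ : ℝ) ^ P.card)⁻¹ ≤
        ((Fintype.card κ : ℝ) ^ (supp s \ D).card)⁻¹ := by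
      rw [hb, ← div_eq_mul_inv, div_div, ← one_div,
        div_le_div_iff₀ (by positivity) (by positivity), ← pow_add, ← pow_add, one_mul]
      exact pow_le_pow_right₀ hk (by omega)
    calc _ = avg F * (b * ((Fintype.card κ : ℝ) ^ P.card)⁻¹) := by ring
      _ ≤ _ := mul_le_mul_of_nonneg_left h3 (avg_nonneg hF0)
  rcases α.eq_empty_or_nonempty with rfl | hα
  · have e : ∀ X : V → κ, condMono s ∅ X = ((Fintype.card κ : ℝ) ^ (r - 1))⁻¹ := by
      intro X; simp [condMono]
    simp only [e, avg_mul_const]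
    refine mul_le_mul_of_nonneg_left ?_ (avg_nonneg hF0)
    exact inv_anti₀ (by positivity) (pow_le_pow_right₀ hk hq)
  · have hA : α.map s ⊆ supp s := Finset.map_subset_map.2 (Finset.subset_univ α)
    have hAc : (α.map s).card = α.card := Finset.card_map _
    have h5 := Finset.card_sdiff_add_card_inter (α.map s) D
    -- If the revealed entries miss `D`, one of them is the pivot and the others follow; the factor
    -- lost is recovered because `s` meets `D` at an unrevealed entry. Otherwise the pivot lies in
    -- `D` and all revealed entries outside `D` follow it.
    rcases (α.map s ∩ D).eq_empty_or_nonempty with h0 | ⟨w, hw⟩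
    · obtain ⟨a, ha⟩ := hα
      have hw : s a ∈ α.map s := Finset.mem_map_of_mem s ha
      refine main ((α.map s).erase (s a)) (s a) (Finset.notMem_erase _ _) ?_ ?_ ?_
      · rw [Finset.disjoint_left]
        intro v hv hvD
        have : v ∈ α.map s ∩ D := Finset.mem_inter.2 ⟨Finset.mem_of_mem_erase hv, hvD⟩
        simp [h0] at this
      · intro v hv
        rwa [Finset.insert_erase hw] at hv
      · rw [Finset.card_erase_of_mem hw, hAc]
        omega
    · have hw' := Finset.mem_inter.1 hw
      refine main (α.map s \ D) w (fun h => (Finset.mem_sdiff.1 h).2 hw'.2)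
        Finset.sdiff_disjoint ?_ ?_
      · intro v hv
        rcases Finset.mem_insert.1 hv with rfl | hv
        · exact hw'.1
        · exact (Finset.mem_sdiff.1 hv).1
      · have h6 : (supp s \ D).card ≤ (α.map s \ D).card + (supp s \ α.map s).card := by
          rw [← Finset.card_union_of_disjoint]
          · refine Finset.card_le_card fun v hv => ?_
            simp only [Finset.mem_union, Finset.mem_sdiff] at hv ⊢
            tauto
          · rw [Finset.disjoint_left]
            intro v h1 h2
            exact (Finset.mem_sdiff.1 h2).2 (Finset.mem_sdiff.1 h1).1
        have h7 := Finset.card_sdiff_add_card_eq_card hA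
        rw [card_supp] at h7
        have := Finset.card_pos.2 hα
        omega

omit [Fintype V] [DecidableEq V] [Nonempty κ] in
lemma abs_monoIncr_le (s : Fin r ↪ V) (i : Fin r) (α : Finset (Fin r)) (X : V → κ) :
    |monoIncr s i α X| ≤ condMono s (insert i α) X + condMono s α X := by
  refine (abs_sub _ _).trans (le_of_eq ?_)
  rw [abs_of_nonneg (condMono_nonneg _ _ _), abs_of_nonneg (condMono_nonneg _ _ _)]

/-- The bound for products of increments along a connected family of tuples, one step. -/
lemma avg_mul_abs_monoIncr_le (s : Fin r ↪ V) (i : Fin r) (α : Finset (Fin r))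
    {F : (V → κ) → ℝ} (hF0 : ∀ X, 0 ≤ F X) {D : Finset V} (hF : DependsOn F (D : Set V))
    (hD : (D ∩ supp s).Nonempty) {K : ℝ}
    (hK : avg F ≤ K * (Fintype.card κ / (Fintype.card κ : ℝ) ^ D.card)) :
    avg (fun X => F X * |monoIncr s i α X|) ≤
      2 * K * (Fintype.card κ / (Fintype.card κ : ℝ) ^ (D ∪ supp s).card) := by
  have hk0 : 0 < (Fintype.card κ : ℝ) := by exact_mod_cast Fintype.card_pos
  rw [Finset.inter_comm] at hD
  have h1 : ∀ X, F X * |monoIncr s i α X| ≤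
      F X * condMono s (insert i α) X + F X * condMono s α X := fun X => by
    rw [← mul_add]
    exact mul_le_mul_of_nonneg_left (abs_monoIncr_le s i α X) (hF0 X)
  refine (avg_mono h1).trans ?_
  rw [avg_add]
  have h2 := avg_mul_condMono_le s (insert i α) hF0 hF hD
  have h3 := avg_mul_condMono_le s α hF0 hF hD
  have h4 : avg F * ((Fintype.card κ : ℝ) ^ (supp s \ D).card)⁻¹ ≤
      K * (Fintype.card κ / (Fintype.card κ : ℝ) ^ (D ∪ supp s).card) := by
    rw [Finset.union_comm, ← Finset.card_sdiff_add_card, pow_add]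
    calc _ ≤ K * (Fintype.card κ / (Fintype.card κ : ℝ) ^ D.card) *
          ((Fintype.card κ : ℝ) ^ (supp s \ D).card)⁻¹ :=
          mul_le_mul_of_nonneg_right hK (by positivity)
      _ = _ := by field_simp
  linarith

lemma avg_abs_monoIncr_le (s : Fin r ↪ V) (i : Fin r) (α : Finset (Fin r)) :
    avg (fun X : V → κ => |monoIncr s i α X|) ≤
      2 * (Fintype.card κ / (Fintype.card κ : ℝ) ^ (supp s).card) := by
  have hk0 : 0 < (Fintype.card κ : ℝ) := by exact_mod_cast Fintype.card_pos
  -- A single vertex starts the connected family: `c / c ^ 1 = 1` is the mean of the constant `1`.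
  have := avg_mul_abs_monoIncr_le s i α (κ := κ) (F := fun _ => 1) (D := {s i}) (K := 1)
    (fun _ => zero_le_one) (fun _ _ _ => rfl) ⟨s i, by simp [mem_supp]⟩ (by
      simp [hk0.ne'])
  simp only [one_mul, mul_one] at this
  rwa [Finset.singleton_union, Finset.insert_eq_of_mem (mem_supp s i)] at this

end Monochromatic

/-! ### Counting families of tuples by the number of their vertices -/

section Counting

variable {V : Type*} [Fintype V] [DecidableEq V]

/-- The number of maps with an image of size `m` is at most `m ^ |ι| * |V| ^ m`. -/
lemma card_filter_card_image_le {ι Θ : Type*} [Fintype ι] [Fintype Θ] {e : Θ → ι → V}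
    (he : Function.Injective e) (m : ℕ) :
    (Finset.univ.filter fun θ => (Finset.univ.image (e θ)).card = m).card ≤
      m ^ Fintype.card ι * Fintype.card V ^ m := by
  classical
  rw [← Finset.card_image_of_injective _ he]
  -- A map whose image has `m` points factors through `Fin m`.
  have hsub : (Finset.univ.filter fun θ => (Finset.univ.image (e θ)).card = m).image e ⊆
      (Finset.univ : Finset ((ι → Fin m) × (Fin m → V))).image fun p => p.2 ∘ p.1 := by
    intro f hf
    obtain ⟨θ, hθ, rfl⟩ := Finset.mem_image.1 hf
    have hm := (Finset.mem_filter.1 hθ).2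
    let q := Finset.equivFinOfCardEq hm
    refine Finset.mem_image.2 ⟨(fun i => q ⟨e θ i, Finset.mem_image_of_mem _ (Finset.mem_univ i)⟩,
      fun k => (q.symm k : V)), Finset.mem_univ _, ?_⟩
    ext i
    simp
  refine (Finset.card_le_card hsub).trans (Finset.card_image_le.trans (le_of_eq ?_))
  simp

/-- The weight `c ^ (1 - m)` for `m ≤ M`, and `0` for `m > M`. -/
def cutWeight (M : ℕ) (c : ℝ) (m : ℕ) : ℝ := if m ≤ M then c / c ^ m else 0

lemma cutWeight_nonneg (M : ℕ) {c : ℝ} (hc : 0 ≤ c) (m : ℕ) : 0 ≤ cutWeight M c m := by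
  unfold cutWeight; positivity

lemma sum_cutWeight_card_image_le {ι Θ : Type*} [Fintype ι] [Fintype Θ] {e : Θ → ι → V}
    (he : Function.Injective e) {r M : ℕ}
    (hr : ∀ θ, r ≤ (Finset.univ.image (e θ)).card) {c : ℝ} (hc : 0 < c) :
    ∑ θ, cutWeight M c (Finset.univ.image (e θ)).card ≤
      (∑ m ∈ Finset.Icc r M, (m : ℝ) ^ Fintype.card ι) *
        (c * ((Fintype.card V / c) ^ r + (Fintype.card V / c) ^ M)) := by
  classical
  have h1 : ∀ θ, cutWeight M c (Finset.univ.image (e θ)).card =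
      ∑ m ∈ Finset.Icc r M, if (Finset.univ.image (e θ)).card = m then c / c ^ m else 0 := by
    intro θ
    rw [Finset.sum_ite_eq]
    simp [cutWeight, hr θ]
  simp only [h1]
  rw [Finset.sum_comm, Finset.sum_mul]
  refine Finset.sum_le_sum fun m hm => ?_
  rw [← Finset.sum_filter, Finset.sum_const, nsmul_eq_mul]
  have h2 : ((Finset.univ.filter fun θ => (Finset.univ.image (e θ)).card = m).card : ℝ) ≤
      (m : ℝ) ^ Fintype.card ι * (Fintype.card V : ℝ) ^ m := by
    exact_mod_cast card_filter_card_image_le he m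
  obtain ⟨hm1, hm2⟩ := Finset.mem_Icc.1 hm
  set l := (Fintype.card V : ℝ) / c with hl
  have hl0 : 0 ≤ l := by positivity
  -- A power with exponent between `r` and `M` is dominated by one of the two extreme powers.
  have h3 : l ^ m ≤ l ^ r + l ^ M := by
    rcases le_total l 1 with h | h
    · linarith [pow_le_pow_of_le_one hl0 h hm1, pow_nonneg hl0 M]
    · linarith [pow_le_pow_right₀ h hm2, pow_nonneg hl0 r]
  calc _ ≤ (m : ℝ) ^ Fintype.card ι * (Fintype.card V : ℝ) ^ m * (c / c ^ m) :=
        mul_le_mul_of_nonneg_right h2 (by positivity)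
    _ = (m : ℝ) ^ Fintype.card ι * (c * l ^ m) := by rw [hl, div_pow]; field_simp
    _ ≤ _ := by gcongr

end Counting

/-! ### Mixed moments of two and four increments -/

section Moments

variable {V κ : Type*} [Fintype V] [DecidableEq V] [Fintype κ] [DecidableEq κ] {r : ℕ}

omit [Fintype V] in
lemma image_univ_eq_supp (s : Fin r ↪ V) : Finset.univ.image s = supp s := by
  ext v; simp [supp]

omit [Fintype V] in
lemma image_sumElim {ι ι' : Type*} [Fintype ι] [Fintype ι'] (f : ι → V) (g : ι' → V) :
    Finset.univ.image (Sum.elim f g) = Finset.univ.image f ∪ Finset.univ.image g := by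
  ext v; simp

omit [Fintype V] in
lemma le_card_supp_union (s : Fin r ↪ V) (T : Finset V) : r ≤ (supp s ∪ T).card := by
  have := Finset.card_le_card (Finset.subset_union_left (s₁ := supp s) (s₂ := T))
  rwa [card_supp] at this

/-- A pair of tuples is one map from `Fin r ⊕ Fin r`, so the count by image size applies. The
constant has to be uniform in `V` and `c`. -/
lemma exists_sum_cutWeight_pair_le (r M : ℕ) : ∃ K : ℝ, 0 ≤ K ∧
    ∀ {V : Type} [Fintype V] [DecidableEq V] {c : ℝ}, 0 < c →
      ∑ s : Fin r ↪ V, ∑ t : Fin r ↪ V, cutWeight M c (supp s ∪ supp t).card ≤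
        K * (c * ((Fintype.card V / c) ^ r + (Fintype.card V / c) ^ M)) := by
  refine ⟨∑ m ∈ Finset.Icc r M, (m : ℝ) ^ Fintype.card (Fin r ⊕ Fin r),
    Finset.sum_nonneg fun _ _ => by positivity, fun {V _ _ c} hc => ?_⟩
  let e : (Fin r ↪ V) × (Fin r ↪ V) → Fin r ⊕ Fin r → V := fun p => Sum.elim p.1 p.2
  have hi : ∀ p, Finset.univ.image (e p) = supp p.1 ∪ supp p.2 := fun p => by
    simp only [e, image_sumElim, image_univ_eq_supp]
  have he : Function.Injective e := by
    intro p q h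
    refine Prod.ext ?_ ?_ <;> ext i
    · exact congrFun h (Sum.inl i)
    · exact congrFun h (Sum.inr i)
  have := sum_cutWeight_card_image_le he (r := r) (M := M) (fun p => by
    rw [hi]; exact le_card_supp_union _ _) hc
  simp only [hi] at this
  rwa [Fintype.sum_prod_type] at this

lemma exists_sum_cutWeight_quad_le (r M : ℕ) : ∃ K : ℝ, 0 ≤ K ∧
    ∀ {V : Type} [Fintype V] [DecidableEq V] {c : ℝ}, 0 < c →
      ∑ s₁ : Fin r ↪ V, ∑ s₂ : Fin r ↪ V, ∑ s₃ : Fin r ↪ V, ∑ s₄ : Fin r ↪ V,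
        cutWeight M c ((supp s₁ ∪ supp s₂) ∪ (supp s₃ ∪ supp s₄)).card ≤
        K * (c * ((Fintype.card V / c) ^ r + (Fintype.card V / c) ^ M)) := by
  refine ⟨∑ m ∈ Finset.Icc r M, (m : ℝ) ^ Fintype.card ((Fin r ⊕ Fin r) ⊕ (Fin r ⊕ Fin r)),
    Finset.sum_nonneg fun _ _ => by positivity, fun {V _ _ c} hc => ?_⟩
  let e : ((Fin r ↪ V) × (Fin r ↪ V)) × ((Fin r ↪ V) × (Fin r ↪ V)) →
      (Fin r ⊕ Fin r) ⊕ (Fin r ⊕ Fin r) → V :=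
    fun p => Sum.elim (Sum.elim p.1.1 p.1.2) (Sum.elim p.2.1 p.2.2)
  have hi : ∀ p, Finset.univ.image (e p) =
      (supp p.1.1 ∪ supp p.1.2) ∪ (supp p.2.1 ∪ supp p.2.2) := fun p => by
    simp only [e, image_sumElim, image_univ_eq_supp]
  have he : Function.Injective e := by
    intro p q h
    refine Prod.ext (Prod.ext ?_ ?_) (Prod.ext ?_ ?_) <;> ext i
    · exact congrFun h (Sum.inl (Sum.inl i))
    · exact congrFun h (Sum.inl (Sum.inr i))
    · exact congrFun h (Sum.inr (Sum.inl i))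
    · exact congrFun h (Sum.inr (Sum.inr i))
  have := sum_cutWeight_card_image_le he (r := r) (M := M) (fun p => by
    rw [hi, Finset.union_assoc]; exact le_card_supp_union _ _) hc
  simp only [hi] at this
  simpa only [Fintype.sum_prod_type] using this

/-- `F` is nonnegative, depends on the colors in `D`, and has the mean of order `c ^ (1 - |D|)` of
a product along a connected family of tuples. -/
structure ConnBound (F : (V → κ) → ℝ) (D : Finset V) (K : ℝ) : Prop where
  nonneg : ∀ X, 0 ≤ F X
  dependsOn : DependsOn F (D : Set V)
  le : avg F ≤ K * (Fintype.card κ / (Fintype.card κ : ℝ) ^ D.card)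

omit [Fintype V] [Fintype κ] [DecidableEq κ] in
lemma dependsOn_mul {F G : (V → κ) → ℝ} {D E : Finset V} (hF : DependsOn F (D : Set V))
    (hG : DependsOn G (E : Set V)) : DependsOn (fun X => F X * G X) ((D ∪ E : Finset V) : Set V) :=
  fun X Y h => by
    simp only
    rw [hF fun v hv => h v (by simpa using Or.inl hv),
      hG fun v hv => h v (by simpa using Or.inr hv)]

variable [Nonempty κ]

lemma connBound_abs_monoIncr (s : Fin r ↪ V) (i : Fin r) (α : Finset (Fin r)) :
    ConnBound (fun X : V → κ => |monoIncr s i α X|) (supp s) 2 where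
  nonneg _ := abs_nonneg _
  dependsOn X Y h := by simp only; rw [dependsOn_monoIncr s i α h]
  le := avg_abs_monoIncr_le s i α

lemma ConnBound.mul_abs_monoIncr {F : (V → κ) → ℝ} {D : Finset V} {K : ℝ} (h : ConnBound F D K)
    (s : Fin r ↪ V) (i : Fin r) (α : Finset (Fin r)) (hD : (D ∩ supp s).Nonempty) :
    ConnBound (fun X => F X * |monoIncr s i α X|) (D ∪ supp s) (2 * K) where
  nonneg X := mul_nonneg (h.nonneg X) (abs_nonneg _)
  dependsOn := dependsOn_mul h.dependsOn (connBound_abs_monoIncr s i α).dependsOn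
  le := avg_mul_abs_monoIncr_le s i α h.nonneg h.dependsOn hD h.le

lemma avg_monoIncr (s : Fin r ↪ V) {i : Fin r} {α : Finset (Fin r)} (hi : i ∉ α) :
    avg (monoIncr s i α : (V → κ) → ℝ) = 0 := by
  rw [← avg_avgOn {s i}]
  rw [show avgOn {s i} (monoIncr s i α : (V → κ) → ℝ) = fun _ => 0 from
    funext (avgOn_monoIncr s hi), avg_zero]

/-- With a single common vertex the increments are uncorrelated and the moment vanishes, as
`monoIncr s i α` has mean zero. With two or more, the union has at most `2r - 2` vertices. -/
lemma abs_avg_monoIncr_mul_le {s t : Fin r ↪ V} {i k : Fin r} {α β : Finset (Fin r)}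
    (hi : i ∉ α) (h : (supp s ∩ supp t).Nonempty) :
    |avg (fun X : V → κ => monoIncr s i α X * monoIncr t k β X)| ≤
      4 * cutWeight (2 * r - 2) (Fintype.card κ) (supp s ∪ supp t).card := by
  have hc := Finset.card_union_add_card_inter (supp s) (supp t)
  rw [card_supp, card_supp] at hc
  by_cases h1 : (supp s ∩ supp t).card ≤ 1
  · rw [avg_mul_of_invariant (dependsOn_monoIncr s i α) (dependsOn_monoIncr t k β)
      (monoIncr_comp_perm s i α) h1, avg_monoIncr s hi, zero_mul, abs_zero]
    exact mul_nonneg (by norm_num) (cutWeight_nonneg _ (by positivity) _)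
  · refine (abs_avg_le _).trans ?_
    simp only [abs_mul]
    have := ((connBound_abs_monoIncr (κ := κ) s i α).mul_abs_monoIncr t k β h).le
    rw [cutWeight, if_pos (by omega)]
    linarith

section Quad

variable {s₁ s₂ s₃ s₄ : Fin r ↪ V} {i₁ i₂ i₃ i₄ : Fin r} {α₁ α₂ α₃ α₄ : Finset (Fin r)}

/-- The tuples can be attached one at a time, each meeting the union of the earlier ones: after `s₁`
and `s₂` comes whichever of `s₃`, `s₄` meets these. Every attachment costs a factor `2`. -/
lemma avg_abs_monoIncr_quad_le (h₁₂ : (supp s₁ ∩ supp s₂).Nonempty)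
    (h₃₄ : (supp s₃ ∩ supp s₄).Nonempty)
    (h : ((supp s₁ ∪ supp s₂) ∩ (supp s₃ ∪ supp s₄)).Nonempty) :
    avg (fun X : V → κ => |monoIncr s₁ i₁ α₁ X * monoIncr s₂ i₂ α₂ X *
        (monoIncr s₃ i₃ α₃ X * monoIncr s₄ i₄ α₄ X)|) ≤
      16 * (Fintype.card κ /
        (Fintype.card κ : ℝ) ^ ((supp s₁ ∪ supp s₂) ∪ (supp s₃ ∪ supp s₄)).card) := by
  have b₂ := (connBound_abs_monoIncr (κ := κ) s₁ i₁ α₁).mul_abs_monoIncr s₂ i₂ α₂ h₁₂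
  rw [Finset.inter_union_distrib_left, Finset.union_nonempty] at h
  obtain ⟨w, hw⟩ := h₃₄
  rw [Finset.mem_inter] at hw
  simp only [abs_mul]
  rcases h with h | h
  · have b₄ := ((b₂.mul_abs_monoIncr s₃ i₃ α₃ h).mul_abs_monoIncr s₄ i₄ α₄
      ⟨w, by simp [hw.1, hw.2]⟩).le
    rw [Finset.union_assoc _ (supp s₃)] at b₄
    rw [show (2 : ℝ) * (2 * (2 * 2)) = 16 by norm_num] at b₄
    simpa only [mul_assoc] using b₄
  · have b₄ := ((b₂.mul_abs_monoIncr s₄ i₄ α₄ h).mul_abs_monoIncr s₃ i₃ α₃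
      ⟨w, by simp [hw.1, hw.2]⟩).le
    rw [Finset.union_assoc _ (supp s₄), Finset.union_comm (supp s₄)] at b₄
    rw [show (2 : ℝ) * (2 * (2 * 2)) = 16 by norm_num] at b₄
    refine le_of_eq_of_le ?_ b₄
    congr 1 with X
    ring

/-- Tuples with a common vertex have at most `3r - 2` vertices in `s₂`, `s₃`, `s₄`. If `s₁` meets
these only once, the moment factorizes and vanishes; otherwise `s₁` adds at most `r - 2`, for a
total of at most `4r - 4`. -/
lemma abs_avg_monoIncr_quad_le (hi : i₁ ∉ α₁) {v : V} (h₁ : v ∈ supp s₁) (h₂ : v ∈ supp s₂)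
    (h₃ : v ∈ supp s₃) (h₄ : v ∈ supp s₄) :
    |avg (fun X : V → κ => monoIncr s₁ i₁ α₁ X * monoIncr s₂ i₂ α₂ X *
        (monoIncr s₃ i₃ α₃ X * monoIncr s₄ i₄ α₄ X))| ≤
      32 * cutWeight (4 * r - 4) (Fintype.card κ)
        ((supp s₁ ∪ supp s₂) ∪ (supp s₃ ∪ supp s₄)).card := by
  have hc := Finset.card_union_add_card_inter (supp s₁) (supp s₂ ∪ (supp s₃ ∪ supp s₄))
  have hc₃₄ := Finset.card_union_add_card_inter (supp s₃) (supp s₄)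
  have hc₂ := Finset.card_union_add_card_inter (supp s₂) (supp s₃ ∪ supp s₄)
  have p₃₄ : 0 < (supp s₃ ∩ supp s₄).card := Finset.card_pos.2 ⟨v, by simp [h₃, h₄]⟩
  have p₂ : 0 < (supp s₂ ∩ (supp s₃ ∪ supp s₄)).card := Finset.card_pos.2 ⟨v, by simp [h₂, h₃]⟩
  rw [card_supp] at hc hc₂
  rw [card_supp, card_supp] at hc₃₄
  have hK : 0 ≤ cutWeight (4 * r - 4) (Fintype.card κ)
      ((supp s₁ ∪ supp s₂) ∪ (supp s₃ ∪ supp s₄)).card := cutWeight_nonneg _ (by positivity) _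
  by_cases hle : (supp s₁ ∩ (supp s₂ ∪ (supp s₃ ∪ supp s₄))).card ≤ 1
  · have := avg_mul_of_invariant (κ := κ) (dependsOn_monoIncr s₁ i₁ α₁)
      (dependsOn_mul (dependsOn_monoIncr s₂ i₂ α₂)
        (dependsOn_mul (dependsOn_monoIncr s₃ i₃ α₃) (dependsOn_monoIncr s₄ i₄ α₄)))
      (monoIncr_comp_perm s₁ i₁ α₁) hle
    simp only [mul_assoc] at this ⊢
    rw [this, avg_monoIncr s₁ hi, zero_mul, abs_zero]
    linarith
  · refine (abs_avg_le _).trans ((avg_abs_monoIncr_quad_le ⟨v, by simp [h₁, h₂]⟩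
      ⟨v, by simp [h₃, h₄]⟩ ⟨v, by simp [h₁, h₃]⟩).trans ?_)
    rw [cutWeight, if_pos] at hK ⊢
    · linarith
    all_goals rw [Finset.union_assoc]; omega

/-- Each pair covers at most `2r - 1` vertices. The covariance vanishes unless the two unions share
at least two, which again leaves `4r - 4`. The constant is `16` for the joint moment plus `4 * 4`
for the product of the means. -/
lemma abs_cov_monoIncr_quad_le {v w : V} (h₁ : v ∈ supp s₁) (h₂ : v ∈ supp s₂)
    (h₃ : w ∈ supp s₃) (h₄ : w ∈ supp s₄) :
    |avg (fun X : V → κ => monoIncr s₁ i₁ α₁ X * monoIncr s₂ i₂ α₂ X *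
        (monoIncr s₃ i₃ α₃ X * monoIncr s₄ i₄ α₄ X)) -
      avg (fun X : V → κ => monoIncr s₁ i₁ α₁ X * monoIncr s₂ i₂ α₂ X) *
        avg (fun X : V → κ => monoIncr s₃ i₃ α₃ X * monoIncr s₄ i₄ α₄ X)| ≤
      32 * cutWeight (4 * r - 4) (Fintype.card κ)
        ((supp s₁ ∪ supp s₂) ∪ (supp s₃ ∪ supp s₄)).card := by
  have hk : 1 ≤ (Fintype.card κ : ℝ) := by exact_mod_cast Fintype.card_pos
  have hk0 : 0 < (Fintype.card κ : ℝ) := by linarith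
  have hc := Finset.card_union_add_card_inter (supp s₁ ∪ supp s₂) (supp s₃ ∪ supp s₄)
  have hc₁₂ := Finset.card_union_add_card_inter (supp s₁) (supp s₂)
  have hc₃₄ := Finset.card_union_add_card_inter (supp s₃) (supp s₄)
  have n₁₂ : (supp s₁ ∩ supp s₂).Nonempty := ⟨v, by simp [h₁, h₂]⟩
  have n₃₄ : (supp s₃ ∩ supp s₄).Nonempty := ⟨w, by simp [h₃, h₄]⟩
  have p₁₂ := Finset.card_pos.2 n₁₂
  have p₃₄ := Finset.card_pos.2 n₃₄
  rw [card_supp, card_supp] at hc₁₂ hc₃₄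
  by_cases hle : ((supp s₁ ∪ supp s₂) ∩ (supp s₃ ∪ supp s₄)).card ≤ 1
  · rw [avg_mul_of_invariant (κ := κ)
      (dependsOn_mul (dependsOn_monoIncr s₁ i₁ α₁) (dependsOn_monoIncr s₂ i₂ α₂))
      (dependsOn_mul (dependsOn_monoIncr s₃ i₃ α₃) (dependsOn_monoIncr s₄ i₄ α₄))
      (fun π X => by simp only [monoIncr_comp_perm]) hle, sub_self, abs_zero]
    exact mul_nonneg (by norm_num) (cutWeight_nonneg _ (by positivity) _)
  · have b₁ := (abs_avg_le _).trans (avg_abs_monoIncr_quad_le (κ := κ) (i₁ := i₁) (i₂ := i₂)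
      (i₃ := i₃) (i₄ := i₄) (α₁ := α₁) (α₂ := α₂) (α₃ := α₃) (α₄ := α₄) n₁₂ n₃₄
      (Finset.card_pos.1 (by omega)))
    have b₁₂ := ((connBound_abs_monoIncr (κ := κ) s₁ i₁ α₁).mul_abs_monoIncr s₂ i₂ α₂ n₁₂).le
    have b₃₄ := ((connBound_abs_monoIncr (κ := κ) s₃ i₃ α₃).mul_abs_monoIncr s₄ i₄ α₄ n₃₄).le
    simp only [← abs_mul] at b₁₂ b₃₄
    have b₂ := mul_le_mul ((abs_avg_le _).trans b₁₂) ((abs_avg_le _).trans b₃₄) (abs_nonneg _)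
      (by positivity)
    rw [← abs_mul] at b₂
    have b₃ : (Fintype.card κ / (Fintype.card κ : ℝ) ^ (supp s₁ ∪ supp s₂).card) *
        (Fintype.card κ / (Fintype.card κ : ℝ) ^ (supp s₃ ∪ supp s₄).card) ≤
        Fintype.card κ /
          (Fintype.card κ : ℝ) ^ ((supp s₁ ∪ supp s₂) ∪ (supp s₃ ∪ supp s₄)).card := by
      rw [div_mul_div_comm, div_le_div_iff₀ (by positivity) (by positivity), ← pow_add, mul_assoc]
      refine mul_le_mul_of_nonneg_left ?_ hk0.le
      rw [← pow_succ']
      exact pow_le_pow_right₀ hk (by omega)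
    rw [cutWeight, if_pos (by omega)]
    refine (abs_sub _ _).trans ((add_le_add b₁ b₂).trans ?_)
    linarith

end Quad

end Moments

/-- The common base vertex has served its purpose once the weights are bounded; the sum is then
enlarged to all pairs. -/
lemma sum_fiber_pair_le {P V : Type*} [Fintype P] [Fintype V] [DecidableEq V] (v : P → V)
    {w : P → P → ℝ} (hw : ∀ p q, 0 ≤ w p q) :
    ∑ j, ∑ p ∈ Finset.univ.filter (fun p => v p = j),
      ∑ q ∈ Finset.univ.filter (fun q => v q = j), w p q ≤ ∑ p, ∑ q, w p q := by
  rw [← Finset.sum_fiberwise Finset.univ v (fun p => ∑ q, w p q)]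
  exact Finset.sum_le_sum fun j _ => Finset.sum_le_sum fun p _ =>
    Finset.sum_le_sum_of_subset_of_nonneg (Finset.subset_univ _) fun q _ _ => hw p q

/-! ### Moment bounds for the increments attached to a vertex -/

section Increments

variable {V κ : Type*} [Fintype V] [DecidableEq V] [Fintype κ] [DecidableEq κ] {r : ℕ}

/-- The weighted sum of the increments of the tuples that reveal the color of the vertex `j`. -/
def incrSum (a : (Fin r ↪ V) → ℝ) (β : Fin r → Finset (Fin r)) (j : V) (X : V → κ) : ℝ :=
  ∑ p ∈ Finset.univ.filter (fun p : (Fin r ↪ V) × Fin r => p.1 p.2 = j),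
    a p.1 * monoIncr p.1 p.2 (β p.2) X

/-- The weighted number of monochromatic tuples. -/
def monoSum (a : (Fin r ↪ V) → ℝ) (X : V → κ) : ℝ := ∑ s, a s * condMono s Finset.univ X

variable [Nonempty κ]

lemma avgOn_incrSum (a : (Fin r ↪ V) → ℝ) {β : Fin r → Finset (Fin r)} (hβ : ∀ i, i ∉ β i)
    (j : V) (X : V → κ) : avgOn {j} (incrSum a β j) X = 0 := by
  unfold incrSum
  rw [avgOn_sum]
  refine Finset.sum_eq_zero fun p hp => ?_
  rw [avgOn_const_mul, ← (Finset.mem_filter.1 hp).2, avgOn_monoIncr _ (hβ _), mul_zero]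

lemma mem_supp_of_mem_filter {p : (Fin r ↪ V) × Fin r} {j : V}
    (hp : p ∈ Finset.univ.filter (fun p : (Fin r ↪ V) × Fin r => p.1 p.2 = j)) :
    j ∈ supp p.1 := (Finset.mem_filter.1 hp).2 ▸ mem_supp _ _

lemma abs_mul_le_of_abs_le_one {x y b : ℝ} (hx : |x| ≤ 1) (hy : |y| ≤ b) : |x * y| ≤ b := by
  rw [abs_mul]
  nlinarith [abs_nonneg x, abs_nonneg y]

lemma sum_avg_incrSum_sq_le {a : (Fin r ↪ V) → ℝ} (ha : ∀ s, |a s| ≤ 1)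
    {β : Fin r → Finset (Fin r)} (hβ : ∀ i, i ∉ β i) :
    ∑ j, avg (fun X : V → κ => incrSum a β j X ^ 2) ≤
      4 * r ^ 2 * ∑ s : Fin r ↪ V, ∑ t : Fin r ↪ V,
        cutWeight (2 * r - 2) (Fintype.card κ) (supp s ∪ supp t).card := by
  have hc : 0 ≤ (Fintype.card κ : ℝ) := by positivity
  calc _ = ∑ j, ∑ p ∈ Finset.univ.filter (fun p : (Fin r ↪ V) × Fin r => p.1 p.2 = j),
      ∑ q ∈ Finset.univ.filter (fun q : (Fin r ↪ V) × Fin r => q.1 q.2 = j),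
        a p.1 * a q.1 * avg (fun X : V → κ =>
          monoIncr p.1 p.2 (β p.2) X * monoIncr q.1 q.2 (β q.2) X) := by
        refine Finset.sum_congr rfl fun j _ => ?_
        simp only [incrSum, sq, Finset.sum_mul_sum, avg_sum]
        refine Finset.sum_congr rfl fun p _ => Finset.sum_congr rfl fun q _ => ?_
        rw [← avg_const_mul]
        congr 1 with X
        ring
    _ ≤ ∑ j, ∑ p ∈ Finset.univ.filter (fun p : (Fin r ↪ V) × Fin r => p.1 p.2 = j),
      ∑ q ∈ Finset.univ.filter (fun q : (Fin r ↪ V) × Fin r => q.1 q.2 = j),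
        4 * cutWeight (2 * r - 2) (Fintype.card κ) (supp p.1 ∪ supp q.1).card := by
        refine Finset.sum_le_sum fun j _ => Finset.sum_le_sum fun p hp =>
          Finset.sum_le_sum fun q hq => (le_abs_self _).trans ?_
        rw [mul_assoc]
        exact abs_mul_le_of_abs_le_one (ha _) (abs_mul_le_of_abs_le_one (ha _)
          (abs_avg_monoIncr_mul_le (hβ _) ⟨j, Finset.mem_inter.2
            ⟨mem_supp_of_mem_filter hp, mem_supp_of_mem_filter hq⟩⟩))
    _ ≤ ∑ p : (Fin r ↪ V) × Fin r, ∑ q : (Fin r ↪ V) × Fin r,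
        4 * cutWeight (2 * r - 2) (Fintype.card κ) (supp p.1 ∪ supp q.1).card :=
        sum_fiber_pair_le (fun p : (Fin r ↪ V) × Fin r => p.1 p.2)
          (w := fun p q => 4 * cutWeight (2 * r - 2) (Fintype.card κ) (supp p.1 ∪ supp q.1).card)
          fun p q => mul_nonneg (by norm_num) (cutWeight_nonneg _ hc _)
    _ = _ := by
        simp only [Fintype.sum_prod_type, Finset.sum_const, Finset.card_univ, Fintype.card_fin,
          nsmul_eq_mul, ← Finset.mul_sum]
        ring

lemma sum_quad_le (r : ℕ) {V : Type*} [Fintype V] [DecidableEq V] {w : ℕ → ℝ} :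
    ∑ p₁ : (Fin r ↪ V) × Fin r, ∑ p₂ : (Fin r ↪ V) × Fin r, ∑ p₃ : (Fin r ↪ V) × Fin r,
      ∑ p₄ : (Fin r ↪ V) × Fin r,
        32 * w ((supp p₁.1 ∪ supp p₂.1) ∪ (supp p₃.1 ∪ supp p₄.1)).card =
      32 * r ^ 4 * ∑ s₁ : Fin r ↪ V, ∑ s₂ : Fin r ↪ V, ∑ s₃ : Fin r ↪ V, ∑ s₄ : Fin r ↪ V,
        w ((supp s₁ ∪ supp s₂) ∪ (supp s₃ ∪ supp s₄)).card := by
  simp only [Fintype.sum_prod_type, Finset.sum_const, Finset.card_univ, Fintype.card_fin,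
    nsmul_eq_mul, ← Finset.mul_sum]
  ring

lemma sum_pow_four {P : Type*} (E : Finset P) (x : P → ℝ) :
    (∑ p ∈ E, x p) ^ 4 =
      ∑ p₁ ∈ E, ∑ p₂ ∈ E, ∑ p₃ ∈ E, ∑ p₄ ∈ E, x p₁ * x p₂ * (x p₃ * x p₄) := by
  have h := Finset.sum_mul_sum E E x x
  calc _ = (∑ p ∈ E, x p) * (∑ p ∈ E, x p) * ((∑ p ∈ E, x p) * (∑ p ∈ E, x p)) := by ring
    _ = (∑ p₁ ∈ E, ∑ p₂ ∈ E, x p₁ * x p₂) * ((∑ p ∈ E, x p) * (∑ p ∈ E, x p)) := by rw [← h]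
    _ = _ := by
        rw [Finset.sum_mul]
        refine Finset.sum_congr rfl fun p₁ _ => ?_
        rw [Finset.sum_mul]
        refine Finset.sum_congr rfl fun p₂ _ => ?_
        rw [h, Finset.mul_sum]
        simp only [Finset.mul_sum]

lemma sum_avg_incrSum_pow_four_le {a : (Fin r ↪ V) → ℝ} (ha : ∀ s, |a s| ≤ 1)
    {β : Fin r → Finset (Fin r)} (hβ : ∀ i, i ∉ β i) :
    ∑ j, avg (fun X : V → κ => incrSum a β j X ^ 4) ≤
      32 * r ^ 4 * ∑ s₁ : Fin r ↪ V, ∑ s₂ : Fin r ↪ V, ∑ s₃ : Fin r ↪ V, ∑ s₄ : Fin r ↪ V,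
        cutWeight (4 * r - 4) (Fintype.card κ)
          ((supp s₁ ∪ supp s₂) ∪ (supp s₃ ∪ supp s₄)).card := by
  have hc : 0 ≤ (Fintype.card κ : ℝ) := by positivity
  set w : ℕ → ℝ := cutWeight (4 * r - 4) (Fintype.card κ) with hw
  have hw0 : ∀ m, 0 ≤ 32 * w m := fun m => mul_nonneg (by norm_num) (cutWeight_nonneg _ hc _)
  rw [← sum_quad_le]
  calc _ = ∑ j, ∑ p₁ ∈ Finset.univ.filter (fun p : (Fin r ↪ V) × Fin r => p.1 p.2 = j),
      ∑ p₂ ∈ Finset.univ.filter (fun p : (Fin r ↪ V) × Fin r => p.1 p.2 = j),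
      ∑ p₃ ∈ Finset.univ.filter (fun p : (Fin r ↪ V) × Fin r => p.1 p.2 = j),
      ∑ p₄ ∈ Finset.univ.filter (fun p : (Fin r ↪ V) × Fin r => p.1 p.2 = j),
        a p₁.1 * (a p₂.1 * (a p₃.1 * (a p₄.1 * avg (fun X : V → κ =>
          monoIncr p₁.1 p₁.2 (β p₁.2) X * monoIncr p₂.1 p₂.2 (β p₂.2) X *
          (monoIncr p₃.1 p₃.2 (β p₃.2) X * monoIncr p₄.1 p₄.2 (β p₄.2) X))))) := by
        refine Finset.sum_congr rfl fun j _ => ?_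
        simp only [incrSum, sum_pow_four, avg_sum]
        refine Finset.sum_congr rfl fun p₁ _ => Finset.sum_congr rfl fun p₂ _ =>
          Finset.sum_congr rfl fun p₃ _ => Finset.sum_congr rfl fun p₄ _ => ?_
        simp only [← avg_const_mul]
        congr 1 with X
        ring
    _ ≤ ∑ j, ∑ p₁ ∈ Finset.univ.filter (fun p : (Fin r ↪ V) × Fin r => p.1 p.2 = j),
      ∑ p₂ ∈ Finset.univ.filter (fun p : (Fin r ↪ V) × Fin r => p.1 p.2 = j),
      ∑ p₃ : (Fin r ↪ V) × Fin r, ∑ p₄ : (Fin r ↪ V) × Fin r,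
        32 * w ((supp p₁.1 ∪ supp p₂.1) ∪ (supp p₃.1 ∪ supp p₄.1)).card := by
        refine Finset.sum_le_sum fun j _ => Finset.sum_le_sum fun p₁ h₁ =>
          Finset.sum_le_sum fun p₂ h₂ => ?_
        -- After the termwise bound, the last two indices are released from the fiber over `j`; the
        -- first two follow through `sum_fiber_pair_le`.
        refine (Finset.sum_le_sum fun p₃ h₃ => (Finset.sum_le_sum fun p₄ h₄ =>
          (le_abs_self _).trans ?_).trans (Finset.sum_le_sum_of_subset_of_nonneg
            (Finset.subset_univ _) fun _ _ _ => hw0 _)).trans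
              (Finset.sum_le_sum_of_subset_of_nonneg
            (Finset.subset_univ _) fun _ _ _ => Finset.sum_nonneg fun _ _ => hw0 _)
        exact abs_mul_le_of_abs_le_one (ha _) (abs_mul_le_of_abs_le_one (ha _)
          (abs_mul_le_of_abs_le_one (ha _) (abs_mul_le_of_abs_le_one (ha _)
          (abs_avg_monoIncr_quad_le (hβ _) (mem_supp_of_mem_filter h₁) (mem_supp_of_mem_filter h₂)
            (mem_supp_of_mem_filter h₃) (mem_supp_of_mem_filter h₄)))))
    _ ≤ _ := sum_fiber_pair_le (fun p : (Fin r ↪ V) × Fin r => p.1 p.2)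
          (w := fun p₁ p₂ => ∑ p₃ : (Fin r ↪ V) × Fin r, ∑ p₄ : (Fin r ↪ V) × Fin r,
            32 * w ((supp p₁.1 ∪ supp p₂.1) ∪ (supp p₃.1 ∪ supp p₄.1)).card)
          fun p q => Finset.sum_nonneg fun _ _ => Finset.sum_nonneg fun _ _ => hw0 _

omit [DecidableEq κ] in
lemma avg_sum_sub_avg_sq {ι : Type*} (E : Finset ι) (z : ι → (V → κ) → ℝ) :
    avg (fun X => (∑ e ∈ E, z e X - avg (fun X => ∑ e ∈ E, z e X)) ^ 2) =
      ∑ e ∈ E, ∑ e' ∈ E, (avg (fun X => z e X * z e' X) - avg (z e) * avg (z e')) := by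
  have h1 : ∀ F : (V → κ) → ℝ, avg (fun X => (F X - avg F) ^ 2) =
      avg (fun X => F X * F X) - avg F * avg F := by
    intro F
    have : (fun X => (F X - avg F) ^ 2) =
        fun X => F X * F X - 2 * avg F * F X + avg F * avg F := by
      ext X; ring
    rw [this, avg_add, avg_sub, avg_const_mul, avg_const]
    ring
  rw [h1]
  simp only [Finset.sum_mul_sum, avg_sum, Finset.sum_sub_distrib]

/-- The variance of `∑ A j R j` expands into covariances of products over pairs of tuples sharing a
revealed vertex. -/
lemma avg_cov_incrSum_le {a : (Fin r ↪ V) → ℝ} (ha : ∀ s, |a s| ≤ 1)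
    (β γ : Fin r → Finset (Fin r)) :
    avg (fun X : V → κ => (∑ j, incrSum a β j X * incrSum a γ j X -
        avg (fun X : V → κ => ∑ j, incrSum a β j X * incrSum a γ j X)) ^ 2) ≤
      32 * r ^ 4 * ∑ s₁ : Fin r ↪ V, ∑ s₂ : Fin r ↪ V, ∑ s₃ : Fin r ↪ V, ∑ s₄ : Fin r ↪ V,
        cutWeight (4 * r - 4) (Fintype.card κ)
          ((supp s₁ ∪ supp s₂) ∪ (supp s₃ ∪ supp s₄)).card := by
  have hc : 0 ≤ (Fintype.card κ : ℝ) := by positivity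
  set w : ℕ → ℝ := cutWeight (4 * r - 4) (Fintype.card κ) with hw
  have hw0 : ∀ m, 0 ≤ 32 * w m := fun m => mul_nonneg (by norm_num) (cutWeight_nonneg _ hc _)
  let P := (Fin r ↪ V) × Fin r
  -- Summing over `j` amounts to summing over the pairs whose revealed vertices coincide.
  let E : Finset (P × P) := Finset.univ.filter fun e => e.1.1 e.1.2 = e.2.1 e.2.2
  let z : P × P → (V → κ) → ℝ := fun e X => (a e.1.1 * a e.2.1) *
    (monoIncr e.1.1 e.1.2 (β e.1.2) X * monoIncr e.2.1 e.2.2 (γ e.2.2) X)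
  have hQ : ∀ X : V → κ, ∑ j, incrSum a β j X * incrSum a γ j X = ∑ e ∈ E, z e X := by
    intro X
    simp only [E, Finset.sum_filter, Fintype.sum_prod_type (α₁ := P) (α₂ := P)]
    rw [← Finset.sum_fiberwise Finset.univ (fun p : P => p.1 p.2)]
    refine Finset.sum_congr rfl fun j _ => ?_
    simp only [incrSum, Finset.sum_mul_sum]
    refine Finset.sum_congr rfl fun p hp => ?_
    rw [Finset.sum_filter]
    refine Finset.sum_congr rfl fun q _ => ?_
    rw [(Finset.mem_filter.1 hp).2]
    simp only [eq_comm (a := j)]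
    split_ifs
    · simp only [z]; ring
    · rfl
  simp only [hQ]
  rw [avg_sum_sub_avg_sq, ← sum_quad_le]
  calc _ ≤ ∑ e ∈ E, ∑ e' ∈ E,
        32 * w ((supp e.1.1 ∪ supp e.2.1) ∪ (supp e'.1.1 ∪ supp e'.2.1)).card := by
        refine Finset.sum_le_sum fun e he => Finset.sum_le_sum fun e' he' =>
          (le_abs_self _).trans ?_
        have h1 := (Finset.mem_filter.1 he).2
        have h2 := (Finset.mem_filter.1 he').2
        have := abs_cov_monoIncr_quad_le (κ := κ) (i₁ := e.1.2) (i₂ := e.2.2) (i₃ := e'.1.2)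
          (i₄ := e'.2.2) (α₁ := β e.1.2) (α₂ := γ e.2.2) (α₃ := β e'.1.2) (α₄ := γ e'.2.2)
          (mem_supp e.1.1 e.1.2) (h1 ▸ mem_supp e.2.1 e.2.2)
          (mem_supp e'.1.1 e'.1.2) (h2 ▸ mem_supp e'.2.1 e'.2.2)
        refine le_of_eq_of_le ?_ (abs_mul_le_of_abs_le_one (ha e.1.1)
          (abs_mul_le_of_abs_le_one (ha e.2.1) (abs_mul_le_of_abs_le_one (ha e'.1.1)
            (abs_mul_le_of_abs_le_one (ha e'.2.1) this))))
        congr 1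
        simp only [z, mul_sub, avg_const_mul]
        congr 1
        · simp only [← avg_const_mul]
          congr 1 with X
          ring
        · ring
    _ ≤ ∑ e : P × P, ∑ e' : P × P,
        32 * w ((supp e.1.1 ∪ supp e.2.1) ∪ (supp e'.1.1 ∪ supp e'.2.1)).card :=
        (Finset.sum_le_sum fun e _ => Finset.sum_le_sum_of_subset_of_nonneg
            (Finset.subset_univ _) fun _ _ _ => hw0 _).trans
          (Finset.sum_le_sum_of_subset_of_nonneg
            (Finset.subset_univ _) fun _ _ _ => Finset.sum_nonneg fun _ _ => hw0 _)
    _ = _ := by simp only [P, Fintype.sum_prod_type (α₁ := P) (α₂ := P)]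

end Increments

/-! ### The two decompositions of the count and the lower bound on its variance -/

section Variance

variable {V κ : Type*} [Fintype V] [DecidableEq V] [Fintype κ] [DecidableEq κ] {r : ℕ}

omit [Fintype V] [DecidableEq V] in
lemma condMono_comp_perm (s : Fin r ↪ V) (α : Finset (Fin r)) (π : Equiv.Perm κ)
    (X : V → κ) : condMono s α (π ∘ X) = condMono s α X := by
  simp [condMono]

omit [Fintype V] [DecidableEq V] in
lemma dependsOn_condMono (s : Fin r ↪ V) (α : Finset (Fin r)) :
    DependsOn (condMono s α : (V → κ) → ℝ) (supp s : Set V) := fun _ _ h =>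
  condMono_congr s α fun i _ => h (s i) (mem_supp s i)

omit [Fintype V] [DecidableEq V] in
lemma condMono_empty (s : Fin r ↪ V) (X : V → κ) :
    condMono s ∅ X = ((Fintype.card κ : ℝ) ^ (r - 1))⁻¹ := by simp [condMono]

omit [Fintype V] [DecidableEq V] in
/-- Revealing the colors of a tuple one after the other. -/
lemma sum_monoIncr_Iio (s : Fin r ↪ V) (X : V → κ) :
    ∑ i, monoIncr s i (Finset.Iio i) X = condMono s Finset.univ X - condMono s ∅ X := by
  -- The sum telescopes along the sets of the first `m` indices.
  let b : ℕ → ℝ := fun m => condMono s (Finset.univ.filter fun i : Fin r => (i : ℕ) < m) X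
  have h : ∀ i : Fin r, monoIncr s i (Finset.Iio i) X = b ((i : ℕ) + 1) - b i := by
    intro i
    simp only [monoIncr, b]
    congr 2
    · ext k
      simp only [Finset.mem_insert, Finset.mem_Iio, Finset.mem_filter, Finset.mem_univ, true_and,
        Fin.ext_iff, Fin.lt_def]
      omega
    · ext k
      simp only [Finset.mem_Iio, Finset.mem_filter, Finset.mem_univ, true_and, Fin.lt_def]
  simp only [h]
  rw [Fin.sum_univ_eq_sum_range (fun m => b (m + 1) - b m) r, Finset.sum_range_sub]
  simp only [b]
  congr 2
  · exact Finset.filter_true_of_mem fun i _ => i.2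
  · exact Finset.filter_false_of_mem fun i _ => by simp

variable [Nonempty κ]

-- This is the family `A j`: with `β i = Finset.Iio i` the increments telescope within every tuple.
omit [Nonempty κ] in
lemma sum_incrSum_Iio (a : (Fin r ↪ V) → ℝ) (X : V → κ) :
    ∑ j, incrSum a (fun i => Finset.Iio i) j X =
      monoSum a X - (∑ s, a s) * ((Fintype.card κ : ℝ) ^ (r - 1))⁻¹ := by
  unfold incrSum
  rw [Finset.sum_fiberwise Finset.univ (fun p : (Fin r ↪ V) × Fin r => p.1 p.2)
    (fun p => a p.1 * monoIncr p.1 p.2 (Finset.Iio p.2) X), Fintype.sum_prod_type]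
  simp only [← Finset.mul_sum, sum_monoIncr_Iio, condMono_empty, mul_sub, Finset.sum_sub_distrib,
    monoSum, Finset.sum_mul]

lemma avg_monoSum (a : (Fin r ↪ V) → ℝ) :
    avg (monoSum a : (V → κ) → ℝ) = (∑ s, a s) * ((Fintype.card κ : ℝ) ^ (r - 1))⁻¹ := by
  have h : avg (fun X : V → κ => ∑ j, incrSum a (fun i => Finset.Iio i) j X) = 0 := by
    rw [avg_sum]
    refine Finset.sum_eq_zero fun j _ => ?_
    rw [← avg_avgOn {j}]
    rw [show avgOn {j} (incrSum a (fun i => Finset.Iio i) j : (V → κ) → ℝ) = fun _ => 0 from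
      funext (avgOn_incrSum a (by simp) j), avg_zero]
  simp only [sum_incrSum_Iio] at h
  rw [avg_sub, avg_const] at h
  have : avg (fun X : V → κ => monoSum a X) = avg (monoSum a : (V → κ) → ℝ) := rfl
  linarith

lemma avg_condMono_univ (s : Fin r ↪ V) :
    avg (condMono s Finset.univ : (V → κ) → ℝ) = ((Fintype.card κ : ℝ) ^ (r - 1))⁻¹ := by
  have h := avg_monoSum (κ := κ) (fun t : Fin r ↪ V => if t = s then 1 else 0)
  have e : (monoSum (fun t : Fin r ↪ V => if t = s then 1 else 0) : (V → κ) → ℝ) =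
      condMono s Finset.univ := by
    ext X; simp [monoSum]
  rw [e] at h
  simpa using h

/-- This is the family `R j`: with `β i = Finset.univ.erase i` the color of `j` is revealed last in
every tuple containing it, and tuples avoiding `j` do not change under resampling. -/
lemma incrSum_erase_eq (a : (Fin r ↪ V) → ℝ) (j : V) (X : V → κ) :
    incrSum a (fun i => Finset.univ.erase i) j X = monoSum a X - avgOn {j} (monoSum a) X := by
  have h : ∀ s : Fin r ↪ V, ∑ i : Fin r,
      (if s i = j then a s * monoIncr s i (Finset.univ.erase i) X else 0) =
      a s * condMono s Finset.univ X - a s * avgOn {j} (condMono s Finset.univ) X := by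
    intro s
    by_cases hj : ∃ i, s i = j
    · obtain ⟨i, rfl⟩ := hj
      simp only [s.apply_eq_iff_eq, Finset.sum_ite_eq', Finset.mem_univ, if_true]
      have := avgOn_condMono_insert s (Finset.notMem_erase i Finset.univ) X
      rw [Finset.insert_erase (Finset.mem_univ i)] at this
      rw [this, monoIncr, Finset.insert_erase (Finset.mem_univ i), mul_sub]
    · push Not at hj
      rw [Finset.sum_eq_zero fun i _ => by simp [hj i], avgOn_of_dependsOn, sub_self]
      refine fun Y Z h => condMono_congr s _ fun i _ => h _ ?_
      simpa using hj i
  have e : (monoSum a : (V → κ) → ℝ) = fun X => ∑ s, a s * condMono s Finset.univ X := rfl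
  rw [incrSum, Finset.sum_filter, Fintype.sum_prod_type, e, avgOn_sum]
  simp only [h, avgOn_const_mul, Finset.sum_sub_distrib]

lemma avg_monoSum_sub_sq (a : (Fin r ↪ V) → ℝ) :
    avg (fun X : V → κ => (monoSum a X - avg (monoSum a : (V → κ) → ℝ)) ^ 2) =
      ∑ s, ∑ t, a s * a t * (avg (fun X : V → κ => condMono s Finset.univ X *
        condMono t Finset.univ X) - avg (condMono s Finset.univ : (V → κ) → ℝ) *
          avg (condMono t Finset.univ : (V → κ) → ℝ)) := by
  have := avg_sum_sub_avg_sq (κ := κ) Finset.univ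
    (fun (s : Fin r ↪ V) (X : V → κ) => a s * condMono s Finset.univ X)
  refine this.trans (Finset.sum_congr rfl fun s _ => Finset.sum_congr rfl fun t _ => ?_)
  have h1 : ∀ u : Fin r ↪ V, avg (fun X : V → κ => a u * condMono u Finset.univ X) =
      a u * avg (condMono u Finset.univ : (V → κ) → ℝ) := fun u => avg_const_mul _ _
  have h2 : avg (fun X : V → κ => a s * condMono s Finset.univ X *
      (a t * condMono t Finset.univ X)) = a s * a t *
        avg (fun X : V → κ => condMono s Finset.univ X * condMono t Finset.univ X) := by
    rw [← avg_const_mul]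
    congr 1 with X
    ring
  rw [h1, h1, h2]
  ring

/-- Both tuples are monochromatic when the whole union has one color, an event of probability `c ^
(1 - m)` for a union of `m` vertices. -/
lemma le_avg_condMono_mul {s t : Fin r ↪ V} (h : (supp s ∩ supp t).Nonempty) :
    Fintype.card κ / (Fintype.card κ : ℝ) ^ (supp s ∪ supp t).card ≤
      avg (fun X : V → κ => condMono s Finset.univ X * condMono t Finset.univ X) := by
  have hk0 : 0 < (Fintype.card κ : ℝ) := by exact_mod_cast Fintype.card_pos
  obtain ⟨w, hw⟩ := h
  have hwU : w ∈ supp s ∪ supp t := Finset.mem_union_left _ (Finset.mem_inter.1 hw).1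
  set P := (supp s ∪ supp t).erase w with hP
  have h1 := avg_mul_forall_eq (κ := κ) (P := P) (Finset.notMem_erase w _) (F := fun _ => 1)
    (fun _ _ _ => rfl)
  rw [avg_const, one_mul] at h1
  have h2 : Fintype.card κ / (Fintype.card κ : ℝ) ^ (supp s ∪ supp t).card =
      ((Fintype.card κ : ℝ) ^ P.card)⁻¹ := by
    rw [← Finset.card_erase_add_one hwU, pow_succ, ← hP]
    field_simp
  rw [h2, ← h1]
  refine avg_mono fun X => ?_
  rw [one_mul]
  split_ifs with hX
  · have hX' : ∀ v ∈ supp s ∪ supp t, X v = X w := fun v hv => by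
      rcases eq_or_ne v w with rfl | hne
      · rfl
      · exact hX v (Finset.mem_erase.2 ⟨hne, hv⟩)
    have e : ∀ u : Fin r ↪ V, supp u ⊆ supp s ∪ supp t → condMono u Finset.univ X = 1 := by
      intro u hu
      have hi : ∀ i, X (u i) = X w := fun i => hX' _ (hu (mem_supp u i))
      rw [condMono, if_pos fun i _ j _ => (hi i).trans (hi j).symm]
      simp [hk0.ne']
    rw [e s Finset.subset_union_left, e t Finset.subset_union_right, one_mul]
  · exact mul_nonneg (condMono_nonneg _ _ _) (condMono_nonneg _ _ _)

/-- The union has at most `2r - 2` vertices, so the product `c ^ (-(2r - 2))` of the means is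
smaller than the joint moment by a factor `1 / c ≤ 1 / 2`. -/
lemma half_le_cov_condMono (hr : 2 ≤ r) (hκ : 2 ≤ Fintype.card κ) {s t : Fin r ↪ V}
    (h : 2 ≤ (supp s ∩ supp t).card) :
    1 / 2 * (Fintype.card κ / (Fintype.card κ : ℝ) ^ (supp s ∪ supp t).card) ≤
      avg (fun X : V → κ => condMono s Finset.univ X * condMono t Finset.univ X) -
        avg (condMono s Finset.univ : (V → κ) → ℝ) *
          avg (condMono t Finset.univ : (V → κ) → ℝ) := by
  have hk : 2 ≤ (Fintype.card κ : ℝ) := by exact_mod_cast hκ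
  have hk0 : 0 < (Fintype.card κ : ℝ) := by linarith
  have h1 := le_avg_condMono_mul (κ := κ) (s := s) (t := t) (Finset.card_pos.1 (by omega))
  have hc := Finset.card_union_add_card_inter (supp s) (supp t)
  rw [card_supp, card_supp] at hc
  rw [avg_condMono_univ, avg_condMono_univ]
  have h2 : ((Fintype.card κ : ℝ) ^ (r - 1))⁻¹ * ((Fintype.card κ : ℝ) ^ (r - 1))⁻¹ ≤
      1 / 2 * (Fintype.card κ / (Fintype.card κ : ℝ) ^ (supp s ∪ supp t).card) := by
    rw [← mul_inv, ← pow_add, ← one_div, div_mul_div_comm, div_le_div_iff₀ (by positivity)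
      (by positivity), one_mul]
    calc 2 * (Fintype.card κ : ℝ) ^ (supp s ∪ supp t).card
        ≤ Fintype.card κ * (Fintype.card κ : ℝ) ^ (supp s ∪ supp t).card := by gcongr
      _ ≤ Fintype.card κ * (Fintype.card κ : ℝ) ^ (r - 1 + (r - 1)) := by
          refine mul_le_mul_of_nonneg_left ?_ hk0.le
          exact pow_le_pow_right₀ (by linarith) (by omega)
      _ = _ := by ring
  linarith

/-- Nonnegativity permits discarding any set of pairs in lower bounds on the variance. -/
lemma cov_condMono_nonneg (hr : 2 ≤ r) (hκ : 2 ≤ Fintype.card κ) (s t : Fin r ↪ V) :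
    0 ≤ avg (fun X : V → κ => condMono s Finset.univ X * condMono t Finset.univ X) -
        avg (condMono s Finset.univ : (V → κ) → ℝ) *
          avg (condMono t Finset.univ : (V → κ) → ℝ) := by
  by_cases h : (supp s ∩ supp t).card ≤ 1
  · rw [avg_mul_of_invariant (dependsOn_condMono s _) (dependsOn_condMono t _)
      (condMono_comp_perm s _) h, sub_self]
  · exact le_trans (by positivity) (half_le_cov_condMono hr hκ (by omega))

/-- The variance is at least the contribution of the single tuples. -/
lemma le_variance_diagonal (hr : 2 ≤ r) (hκ : 2 ≤ Fintype.card κ) {a : (Fin r ↪ V) → ℝ}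
    (ha : ∀ s, a s = 0 ∨ a s = 1) :
    1 / 2 * (∑ s, a s) * (Fintype.card κ / (Fintype.card κ : ℝ) ^ r) ≤
      avg (fun X : V → κ => (monoSum a X - avg (monoSum a : (V → κ) → ℝ)) ^ 2) := by
  have ha0 : ∀ s, 0 ≤ a s := fun s => by rcases ha s with h | h <;> simp [h]
  rw [avg_monoSum_sub_sq, Finset.mul_sum, Finset.sum_mul]
  refine Finset.sum_le_sum fun s _ => ?_
  refine le_trans ?_ (Finset.single_le_sum (fun t _ => mul_nonneg (mul_nonneg (ha0 s) (ha0 t))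
    (cov_condMono_nonneg hr hκ s t)) (Finset.mem_univ s))
  have h := half_le_cov_condMono (κ := κ) hr hκ (s := s) (t := s)
    (by rw [Finset.inter_self, card_supp]; exact hr)
  rw [Finset.union_self, card_supp] at h
  have e : a s * a s = a s := by rcases ha s with h | h <;> simp [h]
  rw [e]
  calc _ = a s * (1 / 2 * (Fintype.card κ / (Fintype.card κ : ℝ) ^ r)) := by ring
    _ ≤ _ := mul_le_mul_of_nonneg_left h (ha0 s)

/-- The variance is at least the contribution of the pairs of tuples with two common entries. -/
lemma le_variance_pairs (hr : 2 ≤ r) (hκ : 2 ≤ Fintype.card κ) {a : (Fin r ↪ V) → ℝ}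
    (ha0 : ∀ s, 0 ≤ a s) :
    1 / 2 * (∑ s, a s) ^ 2 * (Fintype.card κ / (Fintype.card κ : ℝ) ^ (2 * r - 2)) ≤
      (Fintype.card V : ℝ) ^ 2 *
        avg (fun X : V → κ => (monoSum a X - avg (monoSum a : (V → κ) → ℝ)) ^ 2) := by
  have hk : 2 ≤ (Fintype.card κ : ℝ) := by exact_mod_cast hκ
  set b := Fintype.card κ / (Fintype.card κ : ℝ) ^ (2 * r - 2) with hb
  have hb0 : 0 ≤ b := by positivity
  let i₀ : Fin r := ⟨0, by omega⟩
  let i₁ : Fin r := ⟨1, by omega⟩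
  have hi : i₀ ≠ i₁ := by simp [i₀, i₁]
  let v : (Fin r ↪ V) → V × V := fun s => (s i₀, s i₁)
  -- Only pairs agreeing in their first two entries are kept; they share two vertices, so the union
  -- has at most `2r - 2`.
  have key : ∑ s, ∑ t, (if v t = v s then a s * a t else 0) * (1 / 2 * b) ≤
      avg (fun X : V → κ => (monoSum a X - avg (monoSum a : (V → κ) → ℝ)) ^ 2) := by
    rw [avg_monoSum_sub_sq]
    refine Finset.sum_le_sum fun s _ => Finset.sum_le_sum fun t _ => ?_
    split_ifs with h
    · have h0 : t i₀ = s i₀ := congrArg Prod.fst h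
      have h1 : t i₁ = s i₁ := congrArg Prod.snd h
      have h2 : 2 ≤ (supp s ∩ supp t).card := by
        have hsub : {s i₀, s i₁} ⊆ supp s ∩ supp t := by
          intro x hx
          simp only [Finset.mem_insert, Finset.mem_singleton] at hx
          rcases hx with rfl | rfl
          · exact Finset.mem_inter.2 ⟨mem_supp s _, h0 ▸ mem_supp t _⟩
          · exact Finset.mem_inter.2 ⟨mem_supp s _, h1 ▸ mem_supp t _⟩
        have := Finset.card_le_card hsub
        rwa [Finset.card_pair (fun h => hi (s.injective h))] at this
      refine mul_le_mul_of_nonneg_left (le_trans ?_ (half_le_cov_condMono hr hκ h2))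
        (mul_nonneg (ha0 s) (ha0 t))
      have hc := Finset.card_union_add_card_inter (supp s) (supp t)
      rw [card_supp, card_supp] at hc
      refine mul_le_mul_of_nonneg_left ?_ (by norm_num)
      exact div_le_div_of_nonneg_left (by positivity) (by positivity)
        (pow_le_pow_right₀ (by linarith) (by omega))
    · rw [zero_mul]
      exact mul_nonneg (mul_nonneg (ha0 s) (ha0 t)) (cov_condMono_nonneg hr hκ s t)
  -- Cauchy–Schwarz over the `|V| ^ 2` possible values of the first two entries.
  have hcs : (∑ s, a s) ^ 2 ≤ (Fintype.card V : ℝ) ^ 2 *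
      ∑ s, ∑ t, (if v t = v s then a s * a t else 0) := by
    have h1 : ∑ s, ∑ t, (if v t = v s then a s * a t else 0) =
        ∑ e : V × V, (∑ s ∈ Finset.univ.filter (fun s => v s = e), a s) ^ 2 := by
      rw [← Finset.sum_fiberwise Finset.univ v]
      refine Finset.sum_congr rfl fun e _ => ?_
      rw [sq, Finset.sum_mul_sum]
      refine Finset.sum_congr rfl fun s hs => ?_
      rw [(Finset.mem_filter.1 hs).2, ← Finset.sum_filter]
    rw [h1, ← Finset.sum_fiberwise Finset.univ v]
    have := sq_sum_le_card_mul_sum_sq (s := (Finset.univ : Finset (V × V)))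
      (f := fun e => ∑ s ∈ Finset.univ.filter (fun s => v s = e), a s)
    refine this.trans (le_of_eq ?_)
    rw [Finset.card_univ, Fintype.card_prod]
    push_cast
    ring
  simp only [← Finset.sum_mul] at key
  calc _ = (∑ s, a s) ^ 2 * (1 / 2 * b) := by ring
    _ ≤ ((Fintype.card V : ℝ) ^ 2 * ∑ s, ∑ t, (if v t = v s then a s * a t else 0)) *
        (1 / 2 * b) := mul_le_mul_of_nonneg_right hcs (by positivity)
    _ = (Fintype.card V : ℝ) ^ 2 * ((∑ s, ∑ t, (if v t = v s then a s * a t else 0)) *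
        (1 / 2 * b)) := by ring
    _ ≤ _ := mul_le_mul_of_nonneg_left key (by positivity)

/-- The order of magnitude of the variance for a positive fraction of all tuples. -/
lemma le_variance (hr : 2 ≤ r) (hκ : 2 ≤ Fintype.card κ) [Nonempty V] {a : (Fin r ↪ V) → ℝ}
    (ha : ∀ s, a s = 0 ∨ a s = 1) {ε : ℝ} (hε : 0 < ε)
    (hsum : ε * (Fintype.card V : ℝ) ^ r ≤ ∑ s, a s) :
    (Fintype.card κ : ℝ) * (((Fintype.card V : ℝ) / Fintype.card κ) ^ r +
        ((Fintype.card V : ℝ) / Fintype.card κ) ^ (2 * r - 2)) ≤ (2 / ε + 2 / ε ^ 2) *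
      avg (fun X : V → κ => (monoSum a X - avg (monoSum a : (V → κ) → ℝ)) ^ 2) := by
  have hk0 : 0 < (Fintype.card κ : ℝ) := by exact_mod_cast Fintype.card_pos
  have hV0 : 0 < (Fintype.card V : ℝ) := by exact_mod_cast Fintype.card_pos
  have h1 := le_variance_diagonal (κ := κ) hr hκ ha
  have h2 := le_variance_pairs (κ := κ) hr hκ (a := a)
    (fun s => by rcases ha s with h | h <;> simp [h])
  set vr := avg (fun X : V → κ => (monoSum a X - avg (monoSum a : (V → κ) → ℝ)) ^ 2) with hvr
  have h3 : (Fintype.card κ : ℝ) * ((Fintype.card V : ℝ) / Fintype.card κ) ^ r ≤ 2 / ε * vr := by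
    have : 1 / 2 * (ε * (Fintype.card V : ℝ) ^ r) * (Fintype.card κ / (Fintype.card κ : ℝ) ^ r) ≤
        vr := le_trans (by gcongr) h1
    rw [div_mul_eq_mul_div, le_div_iff₀ hε, div_pow]
    calc _ = 2 * (1 / 2 * (ε * (Fintype.card V : ℝ) ^ r) *
          (Fintype.card κ / (Fintype.card κ : ℝ) ^ r)) := by field_simp
      _ ≤ _ := by linarith
  have h4 : (Fintype.card κ : ℝ) * ((Fintype.card V : ℝ) / Fintype.card κ) ^ (2 * r - 2) ≤
      2 / ε ^ 2 * vr := by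
    have h5 : 1 / 2 * (ε * (Fintype.card V : ℝ) ^ r) ^ 2 *
        (Fintype.card κ / (Fintype.card κ : ℝ) ^ (2 * r - 2)) ≤
        (Fintype.card V : ℝ) ^ 2 * vr := le_trans (by gcongr) h2
    have h6 : ((Fintype.card V : ℝ) ^ r) ^ 2 =
        (Fintype.card V : ℝ) ^ 2 * (Fintype.card V : ℝ) ^ (2 * r - 2) := by
      rw [← pow_mul, ← pow_add]; congr 1; omega
    rw [mul_pow, h6] at h5
    have h7 : 1 / 2 * (ε ^ 2 * (Fintype.card V : ℝ) ^ (2 * r - 2)) *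
        (Fintype.card κ / (Fintype.card κ : ℝ) ^ (2 * r - 2)) ≤ vr := by
      refine le_of_mul_le_mul_left (le_of_eq_of_le ?_ h5) (by positivity : 0 < (Fintype.card V : ℝ) ^ 2)
      ring
    rw [div_mul_eq_mul_div, le_div_iff₀ (by positivity), div_pow]
    calc _ = 2 * (1 / 2 * (ε ^ 2 * (Fintype.card V : ℝ) ^ (2 * r - 2)) *
          (Fintype.card κ / (Fintype.card κ : ℝ) ^ (2 * r - 2))) := by field_simp
      _ ≤ _ := by linarith
  rw [mul_add, add_mul]
  linarith

end Variance

/-! ### Combining the moment bounds with the variance bound -/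

/-- The normal approximation for the weighted number of monochromatic tuples. -/
theorem exists_abs_avg_monoSum_sub_integral_le {r : ℕ} (hr : 2 ≤ r) {ε : ℝ} (hε : 0 < ε) :
    ∃ C : ℝ, 0 < C ∧ ∀ {V κ : Type} [Fintype V] [DecidableEq V] [Fintype κ] [DecidableEq κ]
      [Nonempty κ] [Nonempty V], 2 ≤ Fintype.card κ → ∀ a : (Fin r ↪ V) → ℝ,
      (∀ s, a s = 0 ∨ a s = 1) → ε * (Fintype.card V : ℝ) ^ r ≤ ∑ s, a s →
      ∀ h : ℝ → ℝ, LipschitzWith 1 h →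
      |avg (fun X : V → κ => h ((monoSum a X - avg (monoSum a : (V → κ) → ℝ)) /
          √(avg (fun X : V → κ => (monoSum a X - avg (monoSum a : (V → κ) → ℝ)) ^ 2)))) -
        ∫ t, h t ∂(gaussianReal 0 1)| ≤
      C * √(1 / Fintype.card κ +
        (Fintype.card κ : ℝ) ^ (r - 1) / (Fintype.card V : ℝ) ^ r) := by
  obtain ⟨K₂, hK₂, h₂⟩ := exists_sum_cutWeight_pair_le r (2 * r - 2)
  obtain ⟨K₄, hK₄, h₄⟩ := exists_sum_cutWeight_quad_le r (4 * r - 4)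
  set M := 2 / ε + 2 / ε ^ 2 with hM
  have hM0 : 0 < M := by positivity
  set K := 4 * r ^ 2 * K₂ * M + 32 * r ^ 4 * K₄ * M ^ 2 with hK
  have hK0 : 0 ≤ K := by positivity
  refine ⟨2 + 9 * K, by positivity, fun {V κ} _ _ _ _ _ _ hκ a ha hsum h hh => ?_⟩
  have hk0 : 0 < (Fintype.card κ : ℝ) := by exact_mod_cast Fintype.card_pos
  have hV0 : 0 < (Fintype.card V : ℝ) := by exact_mod_cast Fintype.card_pos
  have hvar := le_variance (κ := κ) hr hκ ha hε hsum
  set vr := avg (fun X : V → κ => (monoSum a X - avg (monoSum a : (V → κ) → ℝ)) ^ 2) with hvr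
  set x := ((Fintype.card V : ℝ) / Fintype.card κ) ^ r with hx
  set y := ((Fintype.card V : ℝ) / Fintype.card κ) ^ (2 * r - 2) with hy
  have hx0 : 0 < x := by positivity
  have hy0 : 0 < y := by positivity
  have hvr0 : 0 < vr := by
    have : 0 < M * vr := lt_of_lt_of_le (by positivity) hvar
    exact pos_of_mul_pos_right this hM0.le
  have hy2 : ((Fintype.card V : ℝ) / Fintype.card κ) ^ (4 * r - 4) = y ^ 2 := by
    rw [hy, ← pow_mul]; congr 1; omega
  set η2 := 1 / (Fintype.card κ : ℝ) +
        (Fintype.card κ : ℝ) ^ (r - 1) / (Fintype.card V : ℝ) ^ r with hη2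
  have hη0 : 0 < η2 := by positivity
  have hη : η2 = (1 + 1 / x) / Fintype.card κ := by
    have e : (Fintype.card κ : ℝ) ^ r = (Fintype.card κ : ℝ) ^ (r - 1) * Fintype.card κ := by
      rw [← pow_succ]; congr 1; omega
    rw [hη2, hx, div_pow, e]
    field_simp
  -- This comparison fixes the rate: `η2 = (1 + 1 / x) / c` suffices because `(x + y) ^ 2 * (1 + 1 /
  -- x)` contains both `x` and `y ^ 2`, while `c * (x + y)` is at most `M * vr`.
  have hquad : (Fintype.card κ : ℝ) * (x + y ^ 2) ≤ M ^ 2 * (vr ^ 2 * η2) := by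
    have h1 : ((Fintype.card κ : ℝ) * (x + y)) ^ 2 ≤ (M * vr) ^ 2 :=
      pow_le_pow_left₀ (by positivity) hvar 2
    have h2 : x + y ^ 2 ≤ (x + y) ^ 2 * (1 + 1 / x) := by
      have : (x + y) ^ 2 * (1 + 1 / x) = x + y ^ 2 + (x ^ 2 + 2 * x * y + 2 * y + y ^ 2 / x) := by
        field_simp; ring
      rw [this]
      have : 0 ≤ x ^ 2 + 2 * x * y + 2 * y + y ^ 2 / x := by positivity
      linarith
    calc (Fintype.card κ : ℝ) * (x + y ^ 2)
        ≤ Fintype.card κ * ((x + y) ^ 2 * (1 + 1 / x)) := by gcongr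
      _ = ((Fintype.card κ : ℝ) * (x + y)) ^ 2 * η2 := by rw [hη]; field_simp
      _ ≤ (M * vr) ^ 2 * η2 := by gcongr
      _ = _ := by ring
  have ha1 : ∀ s, |a s| ≤ 1 := fun s => by rcases ha s with h | h <;> simp [h]
  have b4 : 32 * (r : ℝ) ^ 4 * ∑ s₁ : Fin r ↪ V, ∑ s₂ : Fin r ↪ V, ∑ s₃ : Fin r ↪ V,
      ∑ s₄ : Fin r ↪ V, cutWeight (4 * r - 4) (Fintype.card κ)
        ((supp s₁ ∪ supp s₂) ∪ (supp s₃ ∪ supp s₄)).card ≤ K * √vr ^ 4 * √η2 ^ 2 := by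
    have h5 := h₄ (V := V) hk0
    rw [hy2] at h5
    have e4 : √vr ^ 4 = vr ^ 2 := by
      rw [show √vr ^ 4 = (√vr ^ 2) ^ 2 by ring, Real.sq_sqrt hvr0.le]
    rw [e4, Real.sq_sqrt hη0.le]
    calc _ ≤ 32 * (r : ℝ) ^ 4 * (K₄ * (Fintype.card κ * (x + y ^ 2))) := by gcongr
      _ ≤ 32 * (r : ℝ) ^ 4 * (K₄ * (M ^ 2 * (vr ^ 2 * η2))) := by gcongr
      _ = 32 * r ^ 4 * K₄ * M ^ 2 * (vr ^ 2 * η2) := by ring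
      _ ≤ K * (vr ^ 2 * η2) := by
          refine mul_le_mul_of_nonneg_right ?_ (by positivity)
          have : 0 ≤ 4 * (r : ℝ) ^ 2 * K₂ * M := by positivity
          linarith
      _ = _ := by ring
  have b2 : 4 * (r : ℝ) ^ 2 * ∑ s : Fin r ↪ V, ∑ t : Fin r ↪ V,
      cutWeight (2 * r - 2) (Fintype.card κ) (supp s ∪ supp t).card ≤ K * √vr ^ 2 := by
    have h5 := h₂ (V := V) hk0
    rw [Real.sq_sqrt hvr0.le]
    calc _ ≤ 4 * (r : ℝ) ^ 2 * (K₂ * (Fintype.card κ * (x + y))) := by gcongr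
      _ ≤ 4 * (r : ℝ) ^ 2 * (K₂ * (M * vr)) := by gcongr
      _ = 4 * r ^ 2 * K₂ * M * vr := by ring
      _ ≤ K * vr := by
          refine mul_le_mul_of_nonneg_right ?_ hvr0.le
          have : 0 ≤ 32 * (r : ℝ) ^ 4 * K₄ * M ^ 2 := by positivity
          linarith
  exact abs_avg_sub_integral_le_of_moments (Real.sqrt_pos.2 hvr0)
    (A := incrSum a fun i => Finset.Iio i) (R := incrSum a fun i => Finset.univ.erase i)
    (avgOn_incrSum a (by simp)) (fun X => by rw [sum_incrSum_Iio, avg_monoSum])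
    (incrSum_erase_eq a) (Real.sq_sqrt hvr0.le).symm (Real.sqrt_pos.2 hη0)
    ((sum_avg_incrSum_sq_le ha1 (by simp)).trans b2)
    ((sum_avg_incrSum_pow_four_le ha1 (by simp)).trans b4)
    ((avg_cov_incrSum_le ha1 _ _).trans b4) hh

/-! ### From weighted tuples to the law of the standardized count -/

section Bridge

variable {r N c : ℕ}

lemma integral_colorMeasure [NeZero c] (F : (Fin N → Fin c) → ℝ) :
    ∫ X, F X ∂(colorMeasure N c) = avg F := by
  have hμ : colorMeasure N c = uniformOn Set.univ := by
    rw [colorMeasure, ← uniformOn_pi, Set.pi_univ]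
  rw [integral_fintype .of_finite, avg, Fintype.expect_eq_sum_div_card, Finset.sum_div]
  refine Finset.sum_congr rfl fun X _ => ?_
  rw [hμ, measureReal_def, uniformOn_univ, Measure.count_singleton]
  simp [div_eq_inv_mul]

open Classical in
/-- The indicator of the tuples that are copies of `H` in `G`. -/
def copyWeight (H : SimpleGraph (Fin r)) (G : SimpleGraph (Fin N)) (s : Fin r ↪ Fin N) : ℝ :=
  ∏ p ∈ edgePairs H, G.adjMatrix ℝ (s p.1) (s p.2)

lemma copyWeight_eq_zero_or_one (H : SimpleGraph (Fin r)) (G : SimpleGraph (Fin N))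
    (s : Fin r ↪ Fin N) : copyWeight H G s = 0 ∨ copyWeight H G s = 1 := by
  classical
  unfold copyWeight
  by_cases h : ∀ p ∈ edgePairs H, G.Adj (s p.1) (s p.2)
  · right
    exact Finset.prod_eq_one fun p hp => by simp [h p hp]
  · left
    push Not at h
    obtain ⟨p, hp, hn⟩ := h
    exact Finset.prod_eq_zero hp (by simp [hn])

lemma copyWeight_eq_one {H : SimpleGraph (Fin r)} {G : SimpleGraph (Fin N)}
    {s : Fin r ↪ Fin N} (h : ∀ i j, H.Adj i j → G.Adj (s i) (s j)) : copyWeight H G s = 1 := by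
  classical
  refine Finset.prod_eq_one fun p hp => ?_
  have := (Finset.mem_filter.1 hp).2.2
  simp [h _ _ this]

lemma monoCount_eq [NeZero c] (H : SimpleGraph (Fin r)) (G : SimpleGraph (Fin N))
    (X : Fin N → Fin c) :
    monoCount H G X = 1 / (Nat.card (H ≃g H) : ℝ) * monoSum (copyWeight H G) X := by
  have hc : (c : ℝ) ≠ 0 := by exact_mod_cast NeZero.ne c
  unfold monoCount monoSum
  congr 1
  refine Finset.sum_congr rfl fun s _ => ?_
  unfold copyWeight condMono
  congr 1
  simp [hc]

lemma card_aut_pos (H : SimpleGraph (Fin r)) : 0 < (Nat.card (H ≃g H) : ℝ) := by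
  have : Finite (H ≃g H) := Finite.of_injective (fun e => (e : Fin r → Fin r)) DFunLike.coe_injective
  have : Nonempty (H ≃g H) := ⟨RelIso.refl _⟩
  exact_mod_cast Nat.card_pos

/-- The mean of the weighted number of monochromatic copies. -/
lemma meanT_eq [NeZero c] (H : SimpleGraph (Fin r)) (G : SimpleGraph (Fin N)) :
    meanT H G c = 1 / (Nat.card (H ≃g H) : ℝ) *
      avg (monoSum (copyWeight H G) : (Fin N → Fin c) → ℝ) := by
  rw [meanT, integral_colorMeasure, ← avg_const_mul]
  exact congrArg avg (funext fun X => monoCount_eq H G X)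

lemma varT_eq [NeZero c] (H : SimpleGraph (Fin r)) (G : SimpleGraph (Fin N)) :
    varT H G c = (1 / (Nat.card (H ≃g H) : ℝ)) ^ 2 *
      avg (fun X : Fin N → Fin c => (monoSum (copyWeight H G) X -
        avg (monoSum (copyWeight H G) : (Fin N → Fin c) → ℝ)) ^ 2) := by
  rw [varT, variance_eq_integral (measurable_of_finite _).aemeasurable]
  have h := meanT_eq (c := c) H G
  unfold meanT at h
  rw [h, integral_colorMeasure]
  refine Eq.trans (congrArg avg (funext fun X => ?_)) (avg_const_mul _ _)
  simp only [monoCount_eq]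
  ring

/-- The factor `1 / |Aut H|` cancels, also when the variance is zero, since both quotients are then
`0`. -/
lemma stdCount_eq [NeZero c] (H : SimpleGraph (Fin r)) (G : SimpleGraph (Fin N))
    (X : Fin N → Fin c) :
    stdCount H G X = (monoSum (copyWeight H G) X -
        avg (monoSum (copyWeight H G) : (Fin N → Fin c) → ℝ)) /
      √(avg (fun X : Fin N → Fin c => (monoSum (copyWeight H G) X -
        avg (monoSum (copyWeight H G) : (Fin N → Fin c) → ℝ)) ^ 2)) := by
  have hK := card_aut_pos H
  rw [stdCount, varT_eq, meanT_eq, monoCount_eq, Real.sqrt_mul (sq_nonneg _),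
    Real.sqrt_sq (by positivity), ← mul_sub, mul_div_mul_left]
  positivity

lemma integral_map_stdCount [NeZero c] (H : SimpleGraph (Fin r)) (G : SimpleGraph (Fin N))
    {h : ℝ → ℝ} (hh : Continuous h) :
    ∫ x, h x ∂((colorMeasure N c).map (stdCount H G)) =
      avg (fun X : Fin N → Fin c => h (stdCount H G X)) := by
  rw [integral_map (measurable_of_finite _).aemeasurable hh.aestronglyMeasurable,
    integral_colorMeasure]

lemma wasserstein_stdCount_le [NeZero c] (H : SimpleGraph (Fin r)) (G : SimpleGraph (Fin N))
    {B : ℝ} (hB : ∀ h : ℝ → ℝ, LipschitzWith 1 h →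
      |avg (fun X : Fin N → Fin c => h (stdCount H G X)) - ∫ t, h t ∂(gaussianReal 0 1)| ≤ B) :
    wasserstein ((colorMeasure N c).map (stdCount H G)) (gaussianReal 0 1) ≤
      ENNReal.ofReal B := by
  refine iSup₂_le fun h hh => ENNReal.ofReal_le_ofReal ?_
  rw [integral_map_stdCount H G hh.continuous]
  have := hB h hh
  rw [abs_sub_comm] at this
  exact (le_abs_self _).trans this

/-- The second moment is `1`, or `0` if the variance vanishes, and `|z| ≤ (1 + z ^ 2) / 2`. -/
lemma avg_abs_stdCount_le_one [NeZero c] (H : SimpleGraph (Fin r)) (G : SimpleGraph (Fin N)) :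
    avg (fun X : Fin N → Fin c => |stdCount H G X|) ≤ 1 := by
  have h2 : avg (fun X : Fin N → Fin c => stdCount H G X ^ 2) ≤ 1 := by
    simp only [stdCount_eq, div_pow]
    rw [avg_div_const, Real.sq_sqrt (avg_nonneg fun X => sq_nonneg _)]
    exact div_self_le_one _
  have h3 : ∀ X : Fin N → Fin c, |stdCount H G X| ≤ 1 / 2 + 1 / 2 * stdCount H G X ^ 2 := by
    intro X
    nlinarith [sq_nonneg (|stdCount H G X| - 1), sq_abs (stdCount H G X)]
  refine (avg_mono h3).trans ?_
  rw [avg_add, avg_const, avg_const_mul]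
  linarith

/-- The trivial bound on the distance of a standardized variable from the normal law. -/
lemma wasserstein_stdCount_le_two [NeZero c] (H : SimpleGraph (Fin r))
    (G : SimpleGraph (Fin N)) :
    wasserstein ((colorMeasure N c).map (stdCount H G)) (gaussianReal 0 1) ≤
      ENNReal.ofReal 2 := by
  refine wasserstein_stdCount_le H G fun h hh => ?_
  have h1 : ∀ x, |h x - h 0| ≤ |x| := fun x => by
    have := hh.dist_le_mul x 0
    simpa [Real.dist_eq] using this
  have h2 : |∫ t, h t ∂(gaussianReal 0 1) - h 0| ≤ 1 := by
    have := abs_sub_mean_le hh 0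
    rw [abs_sub_comm] at this
    simpa using this
  have h3 : |avg (fun X : Fin N → Fin c => h (stdCount H G X)) - h 0| ≤ 1 := by
    have e : avg (fun X : Fin N → Fin c => h (stdCount H G X)) - h 0 =
        avg (fun X : Fin N → Fin c => h (stdCount H G X) - h 0) := by rw [avg_sub, avg_const]
    rw [e]
    exact (abs_avg_le _).trans ((avg_mono fun X => h1 _).trans (avg_abs_stdCount_le_one H G))
  rw [show avg (fun X : Fin N → Fin c => h (stdCount H G X)) - ∫ t, h t ∂(gaussianReal 0 1) =
    (avg (fun X : Fin N → Fin c => h (stdCount H G X)) - h 0) -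
      (∫ t, h t ∂(gaussianReal 0 1) - h 0) by ring]
  refine (abs_sub _ _).trans ?_
  linarith

lemma abs_integral_sub_le_of_wasserstein_le [NeZero c] {H : SimpleGraph (Fin r)}
    {G : SimpleGraph (Fin N)} {B : ℝ} (hB0 : 0 ≤ B)
    (hB : wasserstein ((colorMeasure N c).map (stdCount H G)) (gaussianReal 0 1) ≤
      ENNReal.ofReal B) {h : ℝ → ℝ} (hh : LipschitzWith 1 h) :
    |∫ t, h t ∂((colorMeasure N c).map (stdCount H G)) - ∫ t, h t ∂(gaussianReal 0 1)| ≤ B := by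
  have key : ∀ f : ℝ → ℝ, LipschitzWith 1 f →
      ∫ x, f x ∂(gaussianReal 0 1) - ∫ x, f x ∂((colorMeasure N c).map (stdCount H G)) ≤ B := by
    intro f hf
    have h1 : ENNReal.ofReal (∫ x, f x ∂(gaussianReal 0 1) -
        ∫ x, f x ∂((colorMeasure N c).map (stdCount H G))) ≤ ENNReal.ofReal B :=
      le_trans (le_iSup₂ (f := fun (f : ℝ → ℝ) (_ : LipschitzWith 1 f) =>
        ENNReal.ofReal (∫ x, f x ∂(gaussianReal 0 1) -
          ∫ x, f x ∂((colorMeasure N c).map (stdCount H G)))) f hf) hB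
    exact (ENNReal.ofReal_le_ofReal_iff hB0).1 h1
  have h1 := key h hh
  have h2 := key (fun x => -h x) hh.neg
  rw [integral_neg, integral_neg] at h2
  rw [abs_le]
  constructor <;> linarith

/-- Almost all homomorphisms into a large graph are injective. -/
lemma homDensity_mul_le (H : SimpleGraph (Fin r)) (G : SimpleGraph (Fin N)) [NeZero N]
    (hr : 1 ≤ r) :
    homDensity H G * (N : ℝ) ^ r ≤ ∑ s, copyWeight H G s +
      (∑ m ∈ Finset.range r, (m : ℝ) ^ r) * (N : ℝ) ^ (r - 1) := by
  classical
  have hN : 1 ≤ (N : ℝ) := by exact_mod_cast NeZero.one_le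
  have hN0 : (N : ℝ) ^ r ≠ 0 := by positivity
  rw [homDensity, div_mul_cancel₀ _ hN0]
  let S : Finset (Fin r → Fin N) := Finset.univ.filter fun f => ∀ i j, H.Adj i j → G.Adj (f i) (f j)
  have hS : Nat.card (H →g G) = S.card := by
    let e : (H →g G) ≃ {f // f ∈ S} :=
      { toFun := fun φ => ⟨φ, Finset.mem_filter.2 ⟨Finset.mem_univ _, fun _ _ h => φ.map_rel h⟩⟩
        invFun := fun f => ⟨f.1, fun {i j} h => (Finset.mem_filter.1 f.2).2 i j h⟩
        left_inv := fun _ => rfl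
        right_inv := fun _ => rfl }
    rw [Nat.card_congr e, Nat.card_eq_fintype_card, Fintype.card_coe]
  have hinj : ((S.filter Function.Injective).card : ℝ) ≤ ∑ s, copyWeight H G s := by
    have h1 : S.filter Function.Injective ⊆
        (Finset.univ.filter fun s : Fin r ↪ Fin N => copyWeight H G s = 1).image
          (fun (s : Fin r ↪ Fin N) (i : Fin r) => s i) := by
      intro f hf
      obtain ⟨hf1, hf2⟩ := Finset.mem_filter.1 hf
      refine Finset.mem_image.2 ⟨⟨f, hf2⟩, Finset.mem_filter.2 ⟨Finset.mem_univ _, ?_⟩, rfl⟩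
      exact copyWeight_eq_one (Finset.mem_filter.1 hf1).2
    have h2 : ((S.filter Function.Injective).card : ℝ) ≤
        ((Finset.univ.filter fun s : Fin r ↪ Fin N => copyWeight H G s = 1).card : ℝ) := by
      exact_mod_cast (Finset.card_le_card h1).trans Finset.card_image_le
    refine h2.trans ?_
    rw [← Finset.sum_boole]
    refine Finset.sum_le_sum fun s _ => ?_
    rcases copyWeight_eq_zero_or_one H G s with h | h <;> simp [h]
  -- A noninjective map has an image of some size `m < r`, and there are at most `m ^ r * N ^ m` of
  -- these.
  have hnon : ((S.filter fun f => ¬ Function.Injective f).card : ℝ) ≤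
      (∑ m ∈ Finset.range r, (m : ℝ) ^ r) * (N : ℝ) ^ (r - 1) := by
    have h1 : S.filter (fun f => ¬ Function.Injective f) ⊆ (Finset.range r).biUnion fun m =>
        Finset.univ.filter fun f : Fin r → Fin N => (Finset.univ.image (id f)).card = m := by
      intro f hf
      have hf2 := (Finset.mem_filter.1 hf).2
      refine Finset.mem_biUnion.2 ⟨(Finset.univ.image f).card, Finset.mem_range.2 ?_, by simp⟩
      refine lt_of_le_of_ne (Finset.card_image_le.trans (by simp)) fun h => hf2 ?_
      have h3 : (Finset.univ.image f).card = (Finset.univ : Finset (Fin r)).card := by simp [h]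
      have := Finset.card_image_iff.1 h3
      rwa [Finset.coe_univ, Set.injOn_univ] at this
    have h2 : (S.filter fun f => ¬ Function.Injective f).card ≤
        ∑ m ∈ Finset.range r, m ^ r * N ^ m := by
      refine (Finset.card_le_card h1).trans (Finset.card_biUnion_le.trans
        (Finset.sum_le_sum fun m _ => ?_))
      have := card_filter_card_image_le (V := Fin N) (e := (id : (Fin r → Fin N) → _))
        Function.injective_id m
      simpa using this
    have h3 : ((S.filter fun f => ¬ Function.Injective f).card : ℝ) ≤
        ∑ m ∈ Finset.range r, (m : ℝ) ^ r * (N : ℝ) ^ m := by exact_mod_cast h2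
    refine h3.trans ?_
    rw [Finset.sum_mul]
    refine Finset.sum_le_sum fun m hm => ?_
    have := Finset.mem_range.1 hm
    exact mul_le_mul_of_nonneg_left (pow_le_pow_right₀ hN (by omega)) (by positivity)
  rw [hS, ← Finset.card_filter_add_card_filter_not (s := S) Function.Injective]
  push_cast
  linarith

lemma sum_copyWeight_le (H : SimpleGraph (Fin r)) (G : SimpleGraph (Fin N)) :
    ∑ s, copyWeight H G s ≤ (N : ℝ) ^ r := by
  have h1 : ∑ s, copyWeight H G s ≤ ∑ _s : Fin r ↪ Fin N, (1 : ℝ) :=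
    Finset.sum_le_sum fun s _ => by
      rcases copyWeight_eq_zero_or_one H G s with h | h <;> simp [h]
  refine h1.trans ?_
  have h2 : Fintype.card (Fin r ↪ Fin N) ≤ N ^ r := by
    have := Fintype.card_le_of_injective (fun s : Fin r ↪ Fin N => (s : Fin r → Fin N))
      DFunLike.coe_injective
    simpa using this
  simp only [Finset.sum_const, Finset.card_univ, nsmul_eq_mul, mul_one]
  exact_mod_cast h2

/-- A positive mean requires at least one copy of `H`, and the diagonal part of the variance is then
positive. -/
lemma varT_pos_of_meanT_pos [NeZero c] (hr : 2 ≤ r) (hc : 2 ≤ c) {H : SimpleGraph (Fin r)}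
    {G : SimpleGraph (Fin N)} (h : 0 < meanT H G c) : 0 < varT H G c := by
  have hK := card_aut_pos H
  have hc0 : 0 < (c : ℝ) := by exact_mod_cast (by omega : 0 < c)
  rw [meanT_eq, avg_monoSum] at h
  have h1 : 0 < ∑ s, copyWeight H G s := by
    have h2 := pos_of_mul_pos_right h (by positivity)
    exact pos_of_mul_pos_left h2 (by positivity)
  have h3 := le_variance_diagonal (κ := Fin c) hr (by simpa using hc)
    (copyWeight_eq_zero_or_one H G)
  rw [varT_eq]
  refine mul_pos (by positivity) (lt_of_lt_of_le ?_ h3)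
  simp only [Fintype.card_fin]
  positivity

/-- Needed for the limit theorem: a diverging mean makes `N ^ r / c ^ (r - 1)` diverge, so the first
term of the rate vanishes. -/
lemma meanT_le [NeZero c] (H : SimpleGraph (Fin r)) (G : SimpleGraph (Fin N)) :
    meanT H G c ≤ (N : ℝ) ^ r / (c : ℝ) ^ (r - 1) := by
  have hK : 1 ≤ (Nat.card (H ≃g H) : ℝ) := by
    have := card_aut_pos H
    exact_mod_cast this
  have hc0 : 0 < (c : ℝ) := by exact_mod_cast NeZero.pos c
  rw [meanT_eq, avg_monoSum, Fintype.card_fin, ← div_eq_mul_inv]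
  have h0 : 0 ≤ ∑ s, copyWeight H G s := Finset.sum_nonneg fun s _ => by
    rcases copyWeight_eq_zero_or_one H G s with h | h <;> simp [h]
  have h1 : (1 : ℝ) / Nat.card (H ≃g H) ≤ 1 := by
    rw [div_le_one (by linarith)]; exact hK
  calc _ ≤ 1 * ((∑ s, copyWeight H G s) / (c : ℝ) ^ (r - 1)) := by gcongr
    _ ≤ _ := by rw [one_mul]; gcongr; exact sum_copyWeight_le H G

end Bridge

/-! ### The rate for a single graph and convergence in distribution -/

/-- The rate of convergence: the bound on the Wasserstein distance, up to a constant. -/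
def rate (r N c : ℕ) : ℝ := √((c : ℝ) ^ (r - 1) / (N : ℝ) ^ r) + √(1 / (c : ℝ))

lemma rate_nonneg (r N c : ℕ) : 0 ≤ rate r N c := by unfold rate; positivity

/-- The quantitative bound for a single graph with many copies of `H`. -/
lemma exists_wasserstein_le {r : ℕ} (hr : 2 ≤ r) {t : ℝ} (ht : 0 < t) :
    ∃ C : ℝ, 0 < C ∧ ∀ (N c : ℕ) [NeZero N] [NeZero c] (H : SimpleGraph (Fin r))
      (G : SimpleGraph (Fin N)), 2 ≤ c → t / 2 ≤ homDensity H G →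
      wasserstein ((colorMeasure N c).map (stdCount H G)) (gaussianReal 0 1) ≤
        ENNReal.ofReal (C * rate r N c) := by
  obtain ⟨C₀, hC₀, h₀⟩ := exists_abs_avg_monoSum_sub_integral_le hr (ε := t / 4) (by positivity)
  set A : ℝ := ∑ m ∈ Finset.range r, (m : ℝ) ^ r with hA
  have hA0 : 0 ≤ A := Finset.sum_nonneg fun _ _ => by positivity
  -- From this size on, the noninjective maps take up at most `t / 4` of the density `t / 2`,
  -- leaving `t / 4` for genuine copies.
  set N₀ : ℝ := 4 * A / t with hN₀
  have hN₀0 : 0 ≤ N₀ := by positivity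
  refine ⟨C₀ + 2 * √(N₀ ^ r), by positivity, fun N c _ _ H G hc hG => ?_⟩
  have hN : 1 ≤ (N : ℝ) := by exact_mod_cast NeZero.one_le
  have hc1 : 1 ≤ (c : ℝ) := by exact_mod_cast (by omega : 1 ≤ c)
  by_cases hNN : N₀ ≤ N
  · have hsum : t / 4 * (N : ℝ) ^ r ≤ ∑ s, copyWeight H G s := by
      have h1 := homDensity_mul_le H G (by omega)
      have h2 : t / 2 * (N : ℝ) ^ r ≤ homDensity H G * (N : ℝ) ^ r := by gcongr
      have h3 : A * (N : ℝ) ^ (r - 1) ≤ t / 4 * (N : ℝ) ^ r := by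
        have e : (N : ℝ) ^ r = N * (N : ℝ) ^ (r - 1) := by
          rw [← pow_succ']; congr 1; omega
        rw [e, ← mul_assoc]
        refine mul_le_mul_of_nonneg_right ?_ (by positivity)
        rw [hN₀, div_le_iff₀ ht] at hNN
        linarith
      linarith
    refine (wasserstein_stdCount_le H G (B := C₀ * √(1 / (c : ℝ) +
      (c : ℝ) ^ (r - 1) / (N : ℝ) ^ r)) fun h hh => ?_).trans (ENNReal.ofReal_le_ofReal ?_)
    · have := h₀ (V := Fin N) (κ := Fin c) (by simpa using hc) (copyWeight H G)
        (copyWeight_eq_zero_or_one H G) (by simpa using hsum) h hh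
      simpa only [stdCount_eq, Fintype.card_fin] using this
    · have h1 : √(1 / (c : ℝ) + (c : ℝ) ^ (r - 1) / (N : ℝ) ^ r) ≤ rate r N c := by
        rw [rate, add_comm]
        refine Real.sqrt_le_iff.2 ⟨by positivity, ?_⟩
        rw [add_sq, Real.sq_sqrt (by positivity), Real.sq_sqrt (by positivity)]
        have : 0 ≤ 2 * √((c : ℝ) ^ (r - 1) / (N : ℝ) ^ r) * √(1 / (c : ℝ)) := by positivity
        linarith
      exact mul_le_mul (le_add_of_nonneg_right (by positivity)) h1 (by positivity) (by positivity)
  · refine (wasserstein_stdCount_le_two H G).trans (ENNReal.ofReal_le_ofReal ?_)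
    push Not at hNN
    -- For `N < N₀` the rate is bounded below, so the trivial distance bound `2` is absorbed into a
    -- constant depending only on `r` and `t`.
    have h1 : 1 ≤ √(N₀ ^ r) * √((c : ℝ) ^ (r - 1) / (N : ℝ) ^ r) := by
      rw [← Real.sqrt_mul (by positivity), Real.one_le_sqrt, mul_div_assoc', one_le_div₀
        (by positivity)]
      have h2 : (N : ℝ) ^ r ≤ N₀ ^ r := by gcongr
      have h3 : (1 : ℝ) ≤ (c : ℝ) ^ (r - 1) := one_le_pow₀ hc1
      nlinarith [pow_pos (by linarith : 0 < (N : ℝ)) r]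
    calc (2 : ℝ) ≤ 2 * √(N₀ ^ r) * √((c : ℝ) ^ (r - 1) / (N : ℝ) ^ r) := by linarith
      _ ≤ _ := by
          refine mul_le_mul (le_add_of_nonneg_left hC₀.le) ?_ (by positivity) (by positivity)
          exact le_add_of_nonneg_right (by positivity)

/-- A vanishing Wasserstein distance entails convergence in distribution. -/
lemma tendstoInDistribution_stdCount {r : ℕ} {N c : ℕ → ℕ} [∀ n, NeZero (c n)]
    {H : SimpleGraph (Fin r)} {G : ∀ n, SimpleGraph (Fin (N n))} {b : ℕ → ℝ}
    (hb0 : ∀ n, 0 ≤ b n) (hb : Tendsto b atTop (𝓝 0))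
    (hw : ∀ᶠ n in atTop, wasserstein ((colorMeasure (N n) (c n)).map (stdCount H (G n)))
      (gaussianReal 0 1) ≤ ENNReal.ofReal (b n)) :
    TendstoInDistribution (fun n => (stdCount H (G n) : (Fin (N n) → Fin (c n)) → ℝ))
      atTop (id : ℝ → ℝ) (fun n => colorMeasure (N n) (c n)) (gaussianReal 0 1) := by
  refine ⟨fun n => (measurable_of_finite _).aemeasurable, aemeasurable_id, ?_⟩
  refine tendsto_iff_forall_lipschitz_integral_tendsto.2 ?_
  rintro f - ⟨L, hL⟩
  simp only [ProbabilityMeasure.coe_mk, Measure.map_id]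
  -- Lipschitz test functions are rescaled to constant `1`; `L + 1` instead of `L` keeps the divisor
  -- positive.
  set K : ℝ := L + 1 with hK
  have hK0 : 0 < K := by positivity
  have hf : LipschitzWith 1 (fun x => K⁻¹ * f x) := by
    refine LipschitzWith.of_dist_le_mul fun x y => ?_
    have := hL.dist_le_mul x y
    rw [Real.dist_eq] at this
    rw [Real.dist_eq, ← mul_sub, abs_mul, abs_of_pos (inv_pos.2 hK0), NNReal.coe_one, one_mul,
      inv_mul_le_iff₀ hK0]
    refine this.trans (mul_le_mul_of_nonneg_right ?_ dist_nonneg)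
    rw [hK]; linarith
  rw [tendsto_iff_dist_tendsto_zero]
  refine squeeze_zero' (Eventually.of_forall fun _ => dist_nonneg) ?_
    (g := fun n => K * b n) (by simpa using hb.const_mul K)
  filter_upwards [hw] with n hn
  have := abs_integral_sub_le_of_wasserstein_le (hb0 n) hn hf
  rw [integral_const_mul, integral_const_mul, ← mul_sub, abs_mul, abs_of_pos (inv_pos.2 hK0),
    inv_mul_le_iff₀ hK0] at this
  rwa [Real.dist_eq]

end MonoSubgraph

end

open MonoSubgraph
theorem theorem1p2 {r : ℕ} (hr : 2 ≤ r) (H : SimpleGraph (Fin r)) (hH : H.Connected)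
    (W : Graphon) (hW : 0 < graphonDensity H W) :
    ∃ C : ℝ, 0 < C ∧
      ∀ (N c : ℕ → ℕ) [∀ n, NeZero (N n)] [∀ n, NeZero (c n)]
        (G : ∀ n, SimpleGraph (Fin (N n))),
        ConvergesTo G W → Tendsto c atTop atTop →
          -- the bound for all large `n`, with a constant that depends only on `H` and `W`
          (∀ᶠ n in atTop,
            wasserstein ((colorMeasure (N n) (c n)).map (stdCount H (G n))) (gaussianReal 0 1) ≤
              ENNReal.ofReal
                (C * (√((c n : ℝ) ^ (r - 1) / (N n : ℝ) ^ r) + √(1 / (c n : ℝ))))) ∧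
          -- the bound for all `n`, with a constant that may depend on the sequence
          (∃ C' : ℝ, 0 < C' ∧ ∀ n,
            wasserstein ((colorMeasure (N n) (c n)).map (stdCount H (G n))) (gaussianReal 0 1) ≤
              ENNReal.ofReal
                (C' * (√((c n : ℝ) ^ (r - 1) / (N n : ℝ) ^ r) + √(1 / (c n : ℝ))))) ∧
          -- the central limit theorem
          (Tendsto (fun n => meanT H (G n) (c n)) atTop atTop →
            (∀ᶠ n in atTop, 0 < varT H (G n) (c n)) ∧
            TendstoInDistribution (fun n => (stdCount H (G n) : (Fin (N n) → Fin (c n)) → ℝ))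
              atTop (id : ℝ → ℝ) (fun n => colorMeasure (N n) (c n)) (gaussianReal 0 1)) := by
  obtain ⟨C, hC, hbound⟩ := exists_wasserstein_le hr hW
  refine ⟨C, hC, fun N c _ _ G hG hc => ?_⟩
  change (∀ᶠ n in atTop, _ ≤ ENNReal.ofReal (C * rate r (N n) (c n))) ∧
    (∃ C' : ℝ, 0 < C' ∧ ∀ n, _ ≤ ENNReal.ofReal (C' * rate r (N n) (c n))) ∧ _
  have hc2 : ∀ᶠ n in atTop, 2 ≤ c n := hc.eventually_ge_atTop 2
  have hlarge : ∀ᶠ n in atTop, wasserstein ((colorMeasure (N n) (c n)).map (stdCount H (G n)))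
      (gaussianReal 0 1) ≤ ENNReal.ofReal (C * rate r (N n) (c n)) := by
    filter_upwards [hc2, (hG r H).eventually_const_le (half_lt_self hW)] with n h1 h2
    exact hbound (N n) (c n) H (G n) h1 h2
  refine ⟨hlarge, ?_, fun hmean => ⟨?_, ?_⟩⟩
  · obtain ⟨n₀, hn₀⟩ := eventually_atTop.1 hlarge
    -- For the finitely many early indices the trivial bound is `2 = 2 * √(c n) * √(1 / c n)`; the
    -- sum dominates each of these factors.
    refine ⟨C + ∑ n ∈ Finset.range n₀, 2 * √(c n), by positivity, fun n => ?_⟩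
    rcases le_or_gt n₀ n with h | h
    · refine (hn₀ n h).trans (ENNReal.ofReal_le_ofReal ?_)
      exact mul_le_mul_of_nonneg_right (le_add_of_nonneg_right (by positivity)) (rate_nonneg _ _ _)
    · refine (wasserstein_stdCount_le_two H (G n)).trans (ENNReal.ofReal_le_ofReal ?_)
      have hcn : 0 < (c n : ℝ) := by exact_mod_cast NeZero.pos (c n)
      have h1 : 2 * √(c n) ≤ ∑ n ∈ Finset.range n₀, 2 * √(c n) :=
        Finset.single_le_sum (f := fun n => 2 * √(c n)) (fun _ _ => by positivity)
          (Finset.mem_range.2 h)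
      calc (2 : ℝ) = 2 * √(c n) * √(1 / (c n : ℝ)) := by
            rw [mul_assoc, ← Real.sqrt_mul hcn.le, mul_one_div_cancel hcn.ne', Real.sqrt_one,
              mul_one]
        _ ≤ _ := mul_le_mul (by linarith) (le_add_of_nonneg_left (by positivity)) (by positivity)
            (by positivity)
  · filter_upwards [hc2, hmean.eventually_gt_atTop 0] with n h1 h2
    exact varT_pos_of_meanT_pos hr h1 h2
  · refine tendstoInDistribution_stdCount (b := fun n => C * rate r (N n) (c n))
      (fun n => mul_nonneg hC.le (rate_nonneg _ _ _)) ?_ hlarge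
    have h1 : Tendsto (fun n => (c n : ℝ) ^ (r - 1) / (N n : ℝ) ^ r) atTop (𝓝 0) := by
      have hN : Tendsto (fun n => (N n : ℝ) ^ r / (c n : ℝ) ^ (r - 1)) atTop atTop :=
        tendsto_atTop_mono (fun n => meanT_le H (G n)) hmean
      refine hN.inv_tendsto_atTop.congr fun n => ?_
      simp only [Pi.inv_apply, inv_div]
    have h2 : Tendsto (fun n => 1 / (c n : ℝ)) atTop (𝓝 0) :=
      tendsto_one_div_atTop_nhds_zero_nat.comp hc
    have h3 := ((h1.sqrt.add h2.sqrt).const_mul C)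
    simpa [rate] using h3
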